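/- Let $\mathrm{Si}(x)=\int_0^x \frac{\sin t}{t}\,dt$, let $J_v(x)=\sum_{m=0}^\infty \frac{(-1)^m}{m!\,\Gamma(v+m+1)}\left(\frac{x}{2}\right)^{2m+v}$ be the Bessel function of the first kind of order $v\in\{0,1,2,\dots\}$, and for each integer $n\ge 0$ put $$\alpha_n = 2\sum_{k=1}^{n}\frac{(-1)^{k-1}}{2k-1}+\frac{(-1)^n}{2n+1}.$$ Then for every integer $n\ge 0$ both integrals below converge absolutely, and $$\int_0^\infty \mathrm{Si}(t)\,J_{2n+1}(t)\,\frac{dt}{t}=\frac{1}{2n+1}\int_0^{\pi/2}\sin((2n+1)t)\cot(t)\,dt=\frac{\alpha_n}{2n+1}=\sum_{k=0}^{n}\frac{(n+k)!}{(n-k)!}\,\frac{2^{2k}(-1)^k}{(2k+1)\,(2k+1)!}.$$ Moreover, the $\alpha_n$ are Neumann coefficients of $\tfrac12\mathrm{Si}$, that is, $\tfrac12\mathrm{Si}(x)=\sum_{n=0}^\infty \alpha_n J_{2n+1}(x)$ (absolutely convergent) for all $x\ge 0$, and they are given by Wilkins' integral formula $$\alpha_n = 2(2n+1)\int_0^\infty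 \tfrac12\mathrm{Si}(t)\,J_{2n+1}(t)\,\frac{dt}{t}\qquad(n\ge 0).$$ -/

import Mathlib

/-- The sine integral `Si x = ∫₀ˣ sin t / t dt`. The integrand at the single point `t = 0`
does not affect the integral. -/
noncomputable def sinIntegral (x : ℝ) : ℝ :=
  ∫ t in (0 : ℝ)..x, Real.sin t / t

/-- The Bessel function of the first kind of order `v = 0, 1, 2, …` on the real line,
`J_v(x) = ∑ₘ (-1)ᵐ / (m! Γ(v + m + 1)) (x / 2)^(2 m + v)`. -/
noncomputable def besselJ (v : ℕ) (x : ℝ) : ℝ :=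
  ∑' m : ℕ, (-1 : ℝ) ^ m / ((m.factorial : ℝ) * Real.Gamma ((v : ℝ) + (m : ℝ) + 1))
    * (x / 2) ^ (2 * m + v)

/-- The numbers `α_n = 2 ∑_{k=1}^n (-1)^(k-1) / (2k - 1) + (-1)^n / (2n + 1)`. -/
noncomputable def neumannAlpha (n : ℕ) : ℝ :=
  2 * ∑ k ∈ Finset.Icc 1 n, (-1 : ℝ) ^ (k - 1) / (2 * (k : ℝ) - 1)
    + (-1 : ℝ) ^ n / (2 * (n : ℝ) + 1)

/-! The substitution `u = t sin θ` gives `Si t / t = ∫ sinc (t sin θ) cos θ dθ` over `(0, π/2)`.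
Fubini then turns the Bessel integral into `∫ cot θ (∫ sin (t sin θ) J_v(t) dt/t) dθ`, whose inner
integral is `sin (vθ) / v` (`integral_sin_mul_besselJ_div`). That value is a boundary limit of the
Laplace transform of `J_v(t)/t`, which is `r^v / v` at `p = (1/r - r)/2`: let `r` tend to `e^{iφ}`,
so that `p` tends to `-i sin φ`. The transform is found from the recurrences of `J_v` alone,
boundedness in `v` selecting the decaying solution (`besselLaplace_eq_pow`).

Convergence rests on `|J_v| ≤ 1`, from the telescoping derivative of `J_0² + 2 ∑ J_k²`, and on the
decay `O(t^{-1/4})` for `v ≥ 1`, from a monotone energy. The sharp exponent is `1/2`, but any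
negative power makes `J_v(t)/t` integrable at infinity.

The cotangent integral is evaluated twice: its increments in `n` are those of `α_n`, and the
expansion of `sin ((2n+1)θ)` in odd powers of `sin θ` gives the factorial sum.

For the Neumann series, `2 J_v' = J_{v-1} - J_{v+1}` and summation by parts with `α_{n+1} - α_n =
c_{n+1} + c_n`, `c_n = (-1)^n/(2n+1)`, reduce the derivative to `sin x = 2 ∑ (-1)^n J_{2n+1}(x)`. -/

/-! ### Power series, derivatives and recurrences of Bessel functions. -/

/-- The entire function with `J_v(x) = (x / 2)^v * besselCore v ((x / 2)^2)`. -/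
noncomputable def besselCore (v : ℕ) (z : ℝ) : ℝ :=
  ∑' m : ℕ, (-z) ^ m / ((m.factorial : ℝ) * ((v + m).factorial : ℝ))

theorem besselCore_term_norm_le (v m : ℕ) (z : ℝ) :
    ‖(-z) ^ m / ((m.factorial : ℝ) * ((v + m).factorial : ℝ))‖
      ≤ |z| ^ m / m.factorial * (1 / v.factorial) := by
  rw [norm_div, norm_pow, norm_neg, Real.norm_eq_abs, Real.norm_eq_abs,
    abs_of_nonneg (by positivity : (0 : ℝ) ≤ (m.factorial : ℝ) * ((v + m).factorial : ℝ)),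
    div_mul_div_comm, mul_one]
  have h : (v.factorial : ℝ) ≤ ((v + m).factorial : ℝ) := by
    exact_mod_cast Nat.factorial_le (Nat.le_add_right v m)
  have hv : (0 : ℝ) < v.factorial := by exact_mod_cast v.factorial_pos
  have hm : (0 : ℝ) < m.factorial := by exact_mod_cast m.factorial_pos
  gcongr

theorem summable_besselCore_term (v : ℕ) (z : ℝ) :
    Summable fun m : ℕ => (-z) ^ m / ((m.factorial : ℝ) * ((v + m).factorial : ℝ)) :=
  .of_norm_bounded ((Real.summable_pow_div_factorial |z|).mul_right _)
    fun m => besselCore_term_norm_le v m z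

theorem abs_besselCore_le (v : ℕ) (z : ℝ) :
    |besselCore v z| ≤ Real.exp |z| / v.factorial := by
  have h : HasSum (fun m : ℕ => |z| ^ m / m.factorial * (1 / v.factorial))
      (Real.exp |z| * (1 / v.factorial)) := by
    refine HasSum.mul_right _ ?_
    rw [Real.exp_eq_exp_ℝ]
    exact NormedSpace.expSeries_div_hasSum_exp |z|
  have := tsum_of_norm_bounded h fun m => besselCore_term_norm_le v m z
  rwa [mul_one_div] at this

theorem besselCore_zero_right (v : ℕ) : besselCore v 0 = 1 / v.factorial := by
  unfold besselCore
  rw [tsum_eq_single 0]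
  · simp
  · intro m hm
    simp [hm]

theorem hasDerivAt_besselCore (v : ℕ) (z : ℝ) :
    HasDerivAt (besselCore v) (-besselCore (v + 1) z) z := by
  set R : ℝ := |z| + 1 with hR
  have hR0 : 0 ≤ R := by positivity
  have hu : Summable fun m : ℕ => (m : ℝ) * R ^ (m - 1) / m.factorial := by
    rw [← summable_nat_add_iff 1]
    refine (Real.summable_pow_div_factorial R).congr fun m => ?_
    rw [Nat.factorial_succ]
    push_cast
    field_simp
  have key := hasDerivAt_tsum_of_isPreconnected (𝕜 := ℝ) (t := Metric.ball (0 : ℝ) R)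
    (g := fun (m : ℕ) (y : ℝ) => (-y) ^ m / ((m.factorial : ℝ) * ((v + m).factorial : ℝ)))
    (g' := fun (m : ℕ) (y : ℝ) => (m : ℝ) * (-y) ^ (m - 1) * (-1) /
      ((m.factorial : ℝ) * ((v + m).factorial : ℝ)))
    (y₀ := 0) (y := z) hu Metric.isOpen_ball (convex_ball _ _).isPreconnected
    (fun m y _ => by
      simpa using (((hasDerivAt_id y).fun_neg.fun_pow m).div_const
        ((m.factorial : ℝ) * ((v + m).factorial : ℝ))))
    (fun m y hy => by
      have hy' : |y| ≤ R := by
        rw [Metric.mem_ball, dist_zero_right, Real.norm_eq_abs] at hy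
        exact hy.le
      rw [norm_div, norm_mul, norm_mul, norm_pow, norm_neg, norm_neg, norm_one, mul_one,
        Real.norm_natCast, Real.norm_eq_abs, Real.norm_eq_abs,
        abs_of_nonneg (by positivity : (0 : ℝ) ≤ (m.factorial : ℝ) * ((v + m).factorial : ℝ))]
      have h1 : (1 : ℝ) ≤ ((v + m).factorial : ℝ) := by
        exact_mod_cast (v + m).factorial_pos
      have hm : (0 : ℝ) < m.factorial := by exact_mod_cast m.factorial_pos
      have : (m.factorial : ℝ) ≤ (m.factorial : ℝ) * ((v + m).factorial : ℝ) :=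
        le_mul_of_one_le_right hm.le h1
      gcongr)
    (by simp [hR]; positivity) (summable_besselCore_term v 0)
    (by rw [Metric.mem_ball, dist_zero_right, Real.norm_eq_abs, hR]; linarith)
  refine key.congr_deriv ?_
  symm
  have hs : Summable fun m : ℕ => (m : ℝ) * (-z) ^ (m - 1) * (-1) /
      ((m.factorial : ℝ) * ((v + m).factorial : ℝ)) := by
    rw [← summable_nat_add_iff 1]
    refine (summable_besselCore_term (v + 1) z).neg.congr fun m => ?_
    rw [show v + 1 + m = v + (m + 1) by ring, Nat.factorial_succ m]
    push_cast
    have hm : (m.factorial : ℝ) ≠ 0 := by exact_mod_cast m.factorial_ne_zero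
    have hm' : ((v + (m + 1)).factorial : ℝ) ≠ 0 := by exact_mod_cast Nat.factorial_ne_zero _
    field_simp
  rw [hs.tsum_eq_zero_add, besselCore, ← tsum_neg]
  simp only [Nat.cast_zero, zero_mul, zero_div, zero_add]
  refine tsum_congr fun m => ?_
  rw [show v + 1 + m = v + (m + 1) by ring, Nat.factorial_succ m]
  push_cast
  have hm : (m.factorial : ℝ) ≠ 0 := by exact_mod_cast m.factorial_ne_zero
  have hm' : ((v + (m + 1)).factorial : ℝ) ≠ 0 := by exact_mod_cast Nat.factorial_ne_zero _
  field_simp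

/-- Since `1/(v+m)! - (v+1)/(v+m+1)! = m/(v+m+1)!`, the term `m = 0` of the difference vanishes, and
shifting `m` by one leaves `-z` times the series of order `v + 2`. -/
theorem besselCore_rec (v : ℕ) (z : ℝ) :
    besselCore v z = ((v : ℝ) + 1) * besselCore (v + 1) z - z * besselCore (v + 2) z := by
  have h1 := (summable_besselCore_term v z).hasSum
  have h2 := ((summable_besselCore_term (v + 1) z).hasSum).mul_left ((v : ℝ) + 1)
  have h3 := ((summable_besselCore_term (v + 2) z).hasSum).mul_left (-z)
  have h4 := h1.sub h2
  have h5 : HasSum (fun m : ℕ => (-z) ^ m / ((m.factorial : ℝ) * ((v + m).factorial : ℝ)) -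
      ((v : ℝ) + 1) * ((-z) ^ m / ((m.factorial : ℝ) * ((v + 1 + m).factorial : ℝ))))
      (-z * besselCore (v + 2) z) := by
    rw [← hasSum_nat_add_iff' 1]
    simp only [Finset.range_one, Finset.sum_singleton]
    have e1 : ∀ m : ℕ, (-z) ^ (m + 1) / (((m + 1).factorial : ℝ) * ((v + (m + 1)).factorial : ℝ)) -
        ((v : ℝ) + 1) * ((-z) ^ (m + 1) /
          (((m + 1).factorial : ℝ) * ((v + 1 + (m + 1)).factorial : ℝ))) =
        -z * ((-z) ^ m / ((m.factorial : ℝ) * ((v + 2 + m).factorial : ℝ))) := by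
      intro m
      rw [show v + 2 + m = v + m + 1 + 1 by ring, show v + (m + 1) = v + m + 1 by ring,
        show v + 1 + (m + 1) = v + m + 1 + 1 by ring, Nat.factorial_succ (v + m + 1),
        Nat.factorial_succ m]
      push_cast
      have hm : (m.factorial : ℝ) ≠ 0 := by exact_mod_cast m.factorial_ne_zero
      have hm' : ((v + m + 1).factorial : ℝ) ≠ 0 := by exact_mod_cast Nat.factorial_ne_zero _
      have hv : (v : ℝ) + m + 1 + 1 ≠ 0 := by positivity
      field_simp
      ring
    have e2 : (-z) ^ 0 / (((0 : ℕ).factorial : ℝ) * ((v + 0).factorial : ℝ)) -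
        ((v : ℝ) + 1) * ((-z) ^ 0 / (((0 : ℕ).factorial : ℝ) * ((v + 1 + 0).factorial : ℝ))) = 0 := by
      have hv : ((v.factorial : ℕ) : ℝ) ≠ 0 := by exact_mod_cast v.factorial_ne_zero
      have hv' : (v : ℝ) + 1 ≠ 0 := by positivity
      simp only [add_zero, pow_zero, Nat.factorial_zero, Nat.cast_one, one_mul,
        Nat.factorial_succ v, Nat.cast_mul, Nat.cast_add]
      field_simp
      ring
    simp only [e1, e2, sub_zero]
    exact h3
  have := h4.unique h5
  change besselCore v z - (v + 1) * besselCore (v + 1) z = _ at this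
  linarith

theorem besselJ_eq_besselCore (v : ℕ) (x : ℝ) :
    besselJ v x = (x / 2) ^ v * besselCore v ((x / 2) ^ 2) := by
  unfold besselJ besselCore
  rw [← tsum_mul_left]
  refine tsum_congr fun m => ?_
  rw [← Nat.cast_add, Real.Gamma_nat_eq_factorial, pow_add, pow_mul, neg_pow ((x / 2) ^ 2)]
  ring

theorem abs_besselJ_le_pow (v : ℕ) (x : ℝ) :
    |besselJ v x| ≤ (|x| / 2) ^ v / v.factorial * Real.exp ((|x| / 2) ^ 2) := by
  rw [besselJ_eq_besselCore, abs_mul, abs_pow, abs_div, abs_two]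
  have := abs_besselCore_le v ((x / 2) ^ 2)
  rw [abs_pow, abs_div, abs_two] at this
  calc _ ≤ (|x| / 2) ^ v * (Real.exp ((|x| / 2) ^ 2) / v.factorial) := by gcongr
    _ = _ := by ring

theorem besselJ_zero_zero : besselJ 0 0 = 1 := by
  simp [besselJ_eq_besselCore, besselCore_zero_right]

theorem besselJ_succ_zero (v : ℕ) : besselJ (v + 1) 0 = 0 := by
  simp [besselJ_eq_besselCore]

theorem besselJ_rec (v : ℕ) (x : ℝ) :
    2 * ((v : ℝ) + 1) * besselJ (v + 1) x = x * (besselJ v x + besselJ (v + 2) x) := by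
  simp only [besselJ_eq_besselCore, besselCore_rec v]
  ring

theorem hasDerivAt_besselJ_zero (x : ℝ) : HasDerivAt (besselJ 0) (-besselJ 1 x) x := by
  have h : besselJ 0 = fun y => besselCore 0 ((y / 2) ^ 2) := by
    funext y
    simp [besselJ_eq_besselCore]
  have h2 : HasDerivAt (fun y : ℝ => (y / 2) ^ 2) (x / 2) x := by
    refine (((hasDerivAt_id x).div_const 2).fun_pow 2).congr_deriv ?_
    simp
    ring
  rw [h]
  refine ((hasDerivAt_besselCore 0 ((x / 2) ^ 2)).comp x h2).congr_deriv ?_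
  rw [besselJ_eq_besselCore]
  ring

theorem hasDerivAt_besselJ_succ (v : ℕ) (x : ℝ) :
    HasDerivAt (besselJ (v + 1)) ((besselJ v x - besselJ (v + 2) x) / 2) x := by
  have h : besselJ (v + 1) = fun y => (y / 2) ^ (v + 1) * besselCore (v + 1) ((y / 2) ^ 2) :=
    funext fun y => besselJ_eq_besselCore _ y
  have h2 : HasDerivAt (fun y : ℝ => (y / 2) ^ 2) (x / 2) x := by
    refine (((hasDerivAt_id x).div_const 2).fun_pow 2).congr_deriv ?_
    simp
    ring
  have h3 : HasDerivAt (fun y : ℝ => (y / 2) ^ (v + 1)) (((v : ℝ) + 1) * (x / 2) ^ v / 2) x := by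
    refine (((hasDerivAt_id x).div_const 2).fun_pow (v + 1)).congr_deriv ?_
    simp
    ring
  rw [h]
  refine (h3.fun_mul ((hasDerivAt_besselCore (v + 1) ((x / 2) ^ 2)).comp x h2)).congr_deriv ?_
  simp only [besselJ_eq_besselCore, besselCore_rec v, Function.comp]
  ring

theorem continuous_besselJ (v : ℕ) : Continuous (besselJ v) := by
  rw [continuous_iff_continuousAt]
  intro x
  cases v with
  | zero => exact (hasDerivAt_besselJ_zero x).continuousAt
  | succ v => exact (hasDerivAt_besselJ_succ v x).continuousAt

/-! ### The uniform bound by 1. -/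

/-- The derivative of `2 J_{k+1}²` is `2 J_k J_{k+1} - 2 J_{k+1} J_{k+2}`, so the sum telescopes. -/
theorem hasDerivAt_sum_sq_besselJ (K : ℕ) (x : ℝ) :
    HasDerivAt (fun y => besselJ 0 y ^ 2 + 2 * ∑ k ∈ Finset.range K, besselJ (k + 1) y ^ 2)
      (-2 * besselJ K x * besselJ (K + 1) x) x := by
  induction K with
  | zero =>
    simp only [Finset.range_zero, Finset.sum_empty, mul_zero, add_zero]
    refine ((hasDerivAt_besselJ_zero x).fun_pow 2).congr_deriv ?_
    simp
  | succ K ih =>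
    simp only [Finset.sum_range_succ, mul_add, ← add_assoc]
    refine (ih.fun_add (((hasDerivAt_besselJ_succ K x).fun_pow 2).const_mul 2)).congr_deriv ?_
    push_cast
    ring

/-- Mean value inequality from `0`, where the sum equals 1. The error term vanishes as `K → ∞` for
fixed `x`. -/
theorem sum_sq_besselJ_le (K : ℕ) (x : ℝ) :
    besselJ 0 x ^ 2 + 2 * ∑ k ∈ Finset.range K, besselJ (k + 1) x ^ 2 ≤
      1 + 2 * ((|x| / 2) ^ K / K.factorial * Real.exp ((|x| / 2) ^ 2)) *
        ((|x| / 2) ^ (K + 1) / (K + 1).factorial * Real.exp ((|x| / 2) ^ 2)) * |x| := by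
  have hb : ∀ (v : ℕ), ∀ y ∈ Set.Icc (-|x|) |x|, |besselJ v y| ≤
      (|x| / 2) ^ v / v.factorial * Real.exp ((|x| / 2) ^ 2) := by
    intro v y hy
    have hy' : |y| ≤ |x| := abs_le.2 hy
    exact (abs_besselJ_le_pow v y).trans (by gcongr)
  have h := Convex.norm_image_sub_le_of_norm_hasDerivWithin_le
    (s := Set.Icc (-|x|) |x|) (x := 0) (y := x)
    (C := 2 * ((|x| / 2) ^ K / K.factorial * Real.exp ((|x| / 2) ^ 2)) *
        ((|x| / 2) ^ (K + 1) / (K + 1).factorial * Real.exp ((|x| / 2) ^ 2)))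
    (fun y _ => (hasDerivAt_sum_sq_besselJ K y).hasDerivWithinAt)
    (fun y hy => by
      rw [norm_mul, norm_mul, norm_neg, Real.norm_two, Real.norm_eq_abs, Real.norm_eq_abs]
      gcongr
      · exact hb K y hy
      · exact hb (K + 1) y hy)
    (convex_Icc _ _) ⟨neg_nonpos.2 (abs_nonneg x), abs_nonneg x⟩ ⟨neg_abs_le x, le_abs_self x⟩
  simp only [besselJ_zero_zero, besselJ_succ_zero, one_pow, sub_zero, Real.norm_eq_abs,
    zero_pow two_ne_zero, Finset.sum_const_zero, mul_zero, add_zero] at h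
  linarith [le_abs_self (besselJ 0 x ^ 2 + 2 * ∑ k ∈ Finset.range K, besselJ (k + 1) x ^ 2 - 1)]

theorem abs_besselJ_le_one (v : ℕ) (x : ℝ) : |besselJ v x| ≤ 1 := by
  have hlim : Filter.Tendsto (fun K : ℕ =>
      1 + 2 * ((|x| / 2) ^ K / K.factorial * Real.exp ((|x| / 2) ^ 2)) *
        ((|x| / 2) ^ (K + 1) / (K + 1).factorial * Real.exp ((|x| / 2) ^ 2)) * |x|)
      Filter.atTop (nhds 1) := by
    have h1 := (FloorSemiring.tendsto_pow_div_factorial_atTop (|x| / 2)).mul_const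
      (Real.exp ((|x| / 2) ^ 2))
    have h2 := h1.comp (Filter.tendsto_add_atTop_nat 1)
    simpa using (((h1.const_mul 2).mul h2).mul_const |x|).const_add 1
  rw [← sq_le_one_iff_abs_le_one]
  refine ge_of_tendsto hlim ?_
  filter_upwards [Filter.eventually_ge_atTop v] with K hK
  refine le_trans ?_ (sum_sq_besselJ_le K x)
  have hnn : ∀ k ∈ Finset.range K, 0 ≤ besselJ (k + 1) x ^ 2 := fun k _ => sq_nonneg _
  cases v with
  | zero => linarith [Finset.sum_nonneg hnn]
  | succ v =>
    have := Finset.single_le_sum hnn (Finset.mem_range.2 (Nat.lt_of_succ_le hK))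
    nlinarith [sq_nonneg (besselJ 0 x), sq_nonneg (besselJ (v + 1) x)]

/-! ### Decay at infinity. -/

theorem hasDerivAt_besselJ {x : ℝ} (hx : x ≠ 0) (v : ℕ) :
    HasDerivAt (besselJ v) (v / x * besselJ v x - besselJ (v + 1) x) x := by
  cases v with
  | zero => simpa using hasDerivAt_besselJ_zero x
  | succ v =>
    refine (hasDerivAt_besselJ_succ v x).congr_deriv ?_
    have := besselJ_rec v x
    push_cast
    field_simp
    linarith

theorem hasDerivAt_besselJ_succ' {x : ℝ} (hx : x ≠ 0) (v : ℕ) :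
    HasDerivAt (besselJ (v + 1)) (besselJ v x - (v + 1) / x * besselJ (v + 1) x) x := by
  refine (hasDerivAt_besselJ_succ v x).congr_deriv ?_
  have := besselJ_rec v x
  field_simp
  linarith

/-- The energy `t (J_{v+1}² + J_v²) - c J_v J_{v+1}` with `c = 2v + 1` has derivative `(c/t) J_v
J_{v+1}`, because this `c` cancels the other terms. It is at most `c/√t` for `t ≥ 1`, so subtracting
`2c√t` makes the energy decrease. Hence `t J_{v+1}² = O(√t)`. -/
theorem exists_abs_besselJ_succ_le_rpow (v : ℕ) :
    ∃ C : ℝ, 0 ≤ C ∧ ∀ t : ℝ, 1 ≤ t → |besselJ (v + 1) t| ≤ C * t ^ (-(1 / 4) : ℝ) := by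
  set c : ℝ := 2 * (v : ℝ) + 1 with hc
  have hc0 : 0 ≤ c := by positivity
  set G : ℝ → ℝ := fun t => t * (besselJ (v + 1) t ^ 2 + besselJ v t ^ 2)
    - c * (besselJ v t * besselJ (v + 1) t) - 2 * c * √t with hG
  have hprod : ∀ t, |besselJ v t * besselJ (v + 1) t| ≤ 1 := by
    intro t
    rw [abs_mul]
    exact mul_le_one₀ (abs_besselJ_le_one _ _) (abs_nonneg _) (abs_besselJ_le_one _ _)
  have hder : ∀ t : ℝ, 1 ≤ t →
      HasDerivAt G (c / t * (besselJ v t * besselJ (v + 1) t) - c / √t) t := by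
    intro t ht
    have ht0 : t ≠ 0 := by positivity
    have hs : √t ≠ 0 := by positivity
    have h1 := hasDerivAt_besselJ ht0 v
    have h2 := hasDerivAt_besselJ_succ' ht0 v
    refine ((((hasDerivAt_id t).fun_mul ((h2.fun_pow 2).fun_add (h1.fun_pow 2))).fun_sub
      ((h1.fun_mul h2).const_mul c)).fun_sub
      ((Real.hasDerivAt_sqrt ht0).const_mul (2 * c))).congr_deriv ?_
    simp only [id, hc]
    field_simp
    ring
  have hanti : AntitoneOn G (Set.Ici 1) := by
    refine antitoneOn_of_hasDerivWithinAt_nonpos (convex_Ici 1)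
      (fun t ht => (hder t ht).continuousAt.continuousWithinAt)
      (fun t ht => (hder t (interior_subset ht)).hasDerivWithinAt) fun t ht => ?_
    have ht1 : (1 : ℝ) ≤ t := interior_subset ht
    have hs : √t ≤ t := Real.sqrt_le_self_iff.2 (Or.inr ht1)
    have hs0 : 0 < √t := by positivity
    have h3 : c / t * (besselJ v t * besselJ (v + 1) t) ≤ c / t * 1 := by
      gcongr
      exact (le_abs_self _).trans (hprod t)
    have h4 : c / t ≤ c / √t := by gcongr
    linarith
  refine ⟨√(|G 1| + 3 * c), Real.sqrt_nonneg _, fun t ht => ?_⟩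
  have ht0 : 0 < t := by positivity
  have h5 : G t ≤ G 1 := hanti (Set.mem_Ici.2 le_rfl) ht ht
  have hs1 : 1 ≤ √t := Real.one_le_sqrt.2 ht
  have hsq : √t * √t = t := Real.mul_self_sqrt ht0.le
  have h6 : t * besselJ (v + 1) t ^ 2 ≤ (|G 1| + 3 * c) * √t := by
    have h7 : G t = t * (besselJ (v + 1) t ^ 2 + besselJ v t ^ 2)
      - c * (besselJ v t * besselJ (v + 1) t) - 2 * c * √t := rfl
    have h8 : c * (besselJ v t * besselJ (v + 1) t) ≤ c * 1 := by
      gcongr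
      exact (le_abs_self _).trans (hprod t)
    have h9 : 0 ≤ t * besselJ v t ^ 2 := by positivity
    have h10 : |G 1| ≤ |G 1| * √t := le_mul_of_one_le_right (abs_nonneg _) hs1
    have h11 : c ≤ c * √t := le_mul_of_one_le_right hc0 hs1
    linarith [le_abs_self (G 1)]
  have h12 : besselJ (v + 1) t ^ 2 ≤ (|G 1| + 3 * c) * (√t)⁻¹ := by
    rw [← div_eq_mul_inv, le_div_iff₀ (by positivity)]
    have : √t * (besselJ (v + 1) t ^ 2 * √t) ≤ √t * (|G 1| + 3 * c) := by
      nlinarith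
    exact le_of_mul_le_mul_left this (by positivity)
  refine abs_le_of_sq_le_sq ?_ (by positivity)
  rw [mul_pow, Real.sq_sqrt (by positivity), ← Real.rpow_natCast (t ^ (-(1 / 4) : ℝ)) 2,
    ← Real.rpow_mul ht0.le]
  rw [Real.sqrt_eq_rpow, ← Real.rpow_neg ht0.le] at h12
  norm_num at h12 ⊢
  exact h12

/-! ### Laplace transforms of Bessel functions. -/

theorem integrableOn_cexp_mul_ofReal {p : ℂ} (hp : 0 < p.re) {f : ℝ → ℝ} (hf : Continuous f)
    (hb : ∀ t, |f t| ≤ 1) :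
    MeasureTheory.IntegrableOn (fun t : ℝ => Complex.exp (-p * t) * (f t : ℂ)) (Set.Ioi 0) := by
  refine MeasureTheory.Integrable.mono' (exp_neg_integrableOn_Ioi 0 hp) ?_ ?_
  · exact Continuous.aestronglyMeasurable (by fun_prop)
  · refine Filter.Eventually.of_forall fun t => ?_
    rw [norm_mul, Complex.norm_exp, Complex.norm_real, Real.norm_eq_abs]
    simp only [neg_mul, Complex.neg_re, Complex.mul_re, Complex.ofReal_re, Complex.ofReal_im,
      mul_zero, sub_zero]
    exact mul_le_of_le_one_right (Real.exp_nonneg _) (hb t)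

theorem laplace_deriv {p : ℂ} (hp : 0 < p.re) {f f' : ℝ → ℝ} (hf : ∀ t, HasDerivAt f (f' t) t)
    (hf' : Continuous f') (hb : ∀ t, |f t| ≤ 1) (hb' : ∀ t, |f' t| ≤ 1) :
    p * ∫ t in Set.Ioi (0 : ℝ), Complex.exp (-p * t) * (f t : ℂ) =
      f 0 + ∫ t in Set.Ioi (0 : ℝ), Complex.exp (-p * t) * (f' t : ℂ) := by
  have hfc : Continuous f := continuous_iff_continuousAt.2 fun t => (hf t).continuousAt
  have i1 := integrableOn_cexp_mul_ofReal hp hfc hb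
  have i2 := integrableOn_cexp_mul_ofReal hp hf' hb'
  have hlim : Filter.Tendsto (fun t : ℝ => Complex.exp (-p * t) * (f t : ℂ)) Filter.atTop
      (nhds 0) := by
    have h0 : Filter.Tendsto (fun t : ℝ => Real.exp (-(p.re * t))) Filter.atTop (nhds 0) :=
      Real.tendsto_exp_neg_atTop_nhds_zero.comp (Filter.tendsto_id.const_mul_atTop hp)
    refine squeeze_zero_norm (fun t => ?_) h0
    rw [norm_mul, Complex.norm_exp, Complex.norm_real, Real.norm_eq_abs]
    simp only [neg_mul, Complex.neg_re, Complex.mul_re, Complex.ofReal_re, Complex.ofReal_im,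
      mul_zero, sub_zero]
    exact mul_le_of_le_one_right (Real.exp_nonneg _) (hb t)
  have hder : ∀ t ∈ Set.Ici (0 : ℝ),
      HasDerivAt (fun t : ℝ => Complex.exp (-p * t) * (f t : ℂ))
        (-p * (Complex.exp (-p * t) * (f t : ℂ)) + Complex.exp (-p * t) * (f' t : ℂ)) t := by
    intro t _
    have h1 : HasDerivAt (fun t : ℝ => Complex.exp (-p * t)) (Complex.exp (-p * t) * (-p)) t := by
      have h2 : HasDerivAt (fun t : ℝ => -p * (t : ℂ)) (-p) t := by
        simpa using (HasDerivAt.ofReal_comp (hasDerivAt_id t)).const_mul (-p)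
      exact h2.cexp
    refine (h1.fun_mul (hf t).ofReal_comp).congr_deriv ?_
    ring
  have := MeasureTheory.integral_Ioi_of_hasDerivAt_of_tendsto' hder
    ((i1.const_mul (-p)).add i2) hlim
  rw [MeasureTheory.integral_add (i1.const_mul (-p)) i2, MeasureTheory.integral_const_mul] at this
  simp only [Complex.ofReal_zero, mul_zero, Complex.exp_zero, one_mul, zero_sub] at this
  linear_combination -this

/-- The Laplace transform of the Bessel function `J_v`. -/
noncomputable def besselLaplace (v : ℕ) (p : ℂ) : ℂ :=
  ∫ t in Set.Ioi (0 : ℝ), Complex.exp (-p * t) * (besselJ v t : ℂ)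

theorem integrableOn_cexp_mul_besselJ {p : ℂ} (hp : 0 < p.re) (v : ℕ) :
    MeasureTheory.IntegrableOn (fun t : ℝ => Complex.exp (-p * t) * (besselJ v t : ℂ))
      (Set.Ioi 0) :=
  integrableOn_cexp_mul_ofReal hp (continuous_besselJ v) (abs_besselJ_le_one v)

/-- The point is uniformity in `v`, which excludes the growing solution of the recurrence below. -/
theorem norm_besselLaplace_le {p : ℂ} (hp : 0 < p.re) (v : ℕ) :
    ‖besselLaplace v p‖ ≤ ∫ t in Set.Ioi (0 : ℝ), Real.exp (-p.re * t) := by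
  refine MeasureTheory.norm_integral_le_of_norm_le (exp_neg_integrableOn_Ioi 0 hp)
    (Filter.Eventually.of_forall fun t => ?_)
  rw [norm_mul, Complex.norm_exp, Complex.norm_real, Real.norm_eq_abs]
  simp only [neg_mul, Complex.neg_re, Complex.mul_re, Complex.ofReal_re, Complex.ofReal_im,
    mul_zero, sub_zero]
  exact mul_le_of_le_one_right (Real.exp_nonneg _) (abs_besselJ_le_one v t)

theorem besselLaplace_zero_eq {p : ℂ} (hp : 0 < p.re) :
    p * besselLaplace 0 p = 1 - besselLaplace 1 p := by
  have := laplace_deriv hp hasDerivAt_besselJ_zero (continuous_besselJ 1).neg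
    (abs_besselJ_le_one 0) (fun t => by rw [abs_neg]; exact abs_besselJ_le_one 1 t)
  simp only [besselJ_zero_zero, Complex.ofReal_neg, mul_neg, MeasureTheory.integral_neg,
    Complex.ofReal_one] at this
  simpa [besselLaplace, sub_eq_add_neg] using this

theorem besselLaplace_rec {p : ℂ} (hp : 0 < p.re) (v : ℕ) :
    2 * p * besselLaplace (v + 1) p = besselLaplace v p - besselLaplace (v + 2) p := by
  have h := laplace_deriv hp (hasDerivAt_besselJ_succ v)
    (((continuous_besselJ v).sub (continuous_besselJ (v + 2))).div_const 2)
    (abs_besselJ_le_one (v + 1)) (fun t => by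
      have h1 := abs_le.1 (abs_besselJ_le_one v t)
      have h2 := abs_le.1 (abs_besselJ_le_one (v + 2) t)
      exact abs_le.2 ⟨by linarith, by linarith⟩)
  have e : ∀ t : ℝ, Complex.exp (-p * t) * (((besselJ v t - besselJ (v + 2) t) / 2 : ℝ) : ℂ) =
      (1 / 2) * (Complex.exp (-p * t) * (besselJ v t : ℂ) -
        Complex.exp (-p * t) * (besselJ (v + 2) t : ℂ)) := by
    intro t
    push_cast
    ring
  simp only [e, MeasureTheory.integral_const_mul, besselJ_succ_zero, Complex.ofReal_zero] at h
  rw [MeasureTheory.integral_sub (integrableOn_cexp_mul_besselJ hp v)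
    (integrableOn_cexp_mul_besselJ hp (v + 2))] at h
  simp only [besselLaplace]
  linear_combination 2 * h

/-- The recurrence in `v` has characteristic roots `r` and `-1/r`. The difference `L_{v+1} - r L_v`
is geometric with ratio `-1/r`, of modulus above 1, yet bounded in `v`; so it is zero. -/
theorem besselLaplace_eq_pow {r p : ℂ} (hr0 : r ≠ 0) (hr : ‖r‖ < 1) (hp : 0 < p.re)
    (hpr : 2 * p * r = 1 - r ^ 2) (v : ℕ) : besselLaplace v p = r ^ v * besselLaplace 0 p := by
  have hD : ∀ v : ℕ, besselLaplace 1 p - r * besselLaplace 0 p =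
      (-r) ^ v * (besselLaplace (v + 1) p - r * besselLaplace v p) := by
    intro v
    induction v with
    | zero => simp
    | succ v ih =>
      rw [ih]
      have := besselLaplace_rec hp v
      have h2 : besselLaplace (v + 2) p = besselLaplace v p - 2 * p * besselLaplace (v + 1) p := by
        linear_combination this
      rw [h2, pow_succ]
      linear_combination (-(-r) ^ v * besselLaplace (v + 1) p) * hpr
  have h0 : besselLaplace 1 p - r * besselLaplace 0 p = 0 := by
    set B := ∫ t in Set.Ioi (0 : ℝ), Real.exp (-p.re * t) with hB
    have hlim : Filter.Tendsto (fun v : ℕ => ‖r‖ ^ v * (B + ‖r‖ * B)) Filter.atTop (nhds 0) := by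
      simpa using (tendsto_pow_atTop_nhds_zero_of_lt_one (norm_nonneg r) hr).mul_const
        (B + ‖r‖ * B)
    refine norm_le_zero_iff.1 (ge_of_tendsto' hlim fun v => ?_)
    rw [hD v, norm_mul, norm_pow, norm_neg]
    gcongr
    refine (norm_sub_le _ _).trans ?_
    rw [norm_mul]
    gcongr
    · exact norm_besselLaplace_le hp _
    · exact norm_besselLaplace_le hp _
  induction v with
  | zero => simp
  | succ v ih =>
    have h := hD v
    rw [h0] at h
    have h1 := (mul_eq_zero.1 h.symm).resolve_left (pow_ne_zero _ (neg_ne_zero.2 hr0))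
    rw [sub_eq_zero.1 h1, ih, pow_succ]
    ring

theorem besselJ_div_eq {t : ℝ} (ht : t ≠ 0) (v : ℕ) :
    besselJ (v + 1) t / t = (besselJ v t + besselJ (v + 2) t) / (2 * (v + 1)) := by
  have := besselJ_rec v t
  have hv : (v : ℝ) + 1 ≠ 0 := by positivity
  field_simp
  linarith

/-- Writing `J_{v+1}/t` through `J_v + J_{v+2}` gives `r^v (1 + r²) L_0 / (2(v+1))`, and `p L_0 = 1
- r L_0` forces `(1 + r²) L_0 = 2r`. -/
theorem laplace_besselJ_div {r p : ℂ} (hr0 : r ≠ 0) (hr : ‖r‖ < 1) (hp : 0 < p.re)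
    (hpr : 2 * p * r = 1 - r ^ 2) (v : ℕ) :
    ∫ t in Set.Ioi (0 : ℝ), Complex.exp (-p * t) * ((besselJ (v + 1) t / t : ℝ) : ℂ) =
      r ^ (v + 1) / (v + 1) := by
  have hv : (v : ℂ) + 1 ≠ 0 := by exact_mod_cast v.succ_ne_zero
  have e : ∫ t in Set.Ioi (0 : ℝ), Complex.exp (-p * t) * ((besselJ (v + 1) t / t : ℝ) : ℂ) =
      ∫ t in Set.Ioi (0 : ℝ), (1 / (2 * ((v : ℂ) + 1))) *
        (Complex.exp (-p * t) * (besselJ v t : ℂ) +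
          Complex.exp (-p * t) * (besselJ (v + 2) t : ℂ)) := by
    refine MeasureTheory.setIntegral_congr_fun measurableSet_Ioi fun t ht => ?_
    simp only [besselJ_div_eq (ne_of_gt ht)]
    push_cast
    field_simp
  have h0 := besselLaplace_zero_eq hp
  rw [besselLaplace_eq_pow hr0 hr hp hpr 1, pow_one] at h0
  have h1 : (1 + r ^ 2) * besselLaplace 0 p = 2 * r := by
    linear_combination 2 * r * h0 - besselLaplace 0 p * hpr
  rw [e, MeasureTheory.integral_const_mul, MeasureTheory.integral_add
    (integrableOn_cexp_mul_besselJ hp v) (integrableOn_cexp_mul_besselJ hp (v + 2))]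
  change _ * (besselLaplace v p + besselLaplace (v + 2) p) = _
  rw [besselLaplace_eq_pow hr0 hr hp hpr v, besselLaplace_eq_pow hr0 hr hp hpr (v + 2)]
  field_simp
  linear_combination r ^ v * h1

/-! ### Absolute integrability and the sine transform of `J_v(t)/t`. -/

/-- Near `0` the condition `-1 < s` suffices since `|J| ≤ 1`; at infinity the decay requires `s -
1/4 < -1`. The value `s = -7/8` used later lies in this window. -/
theorem integrableOn_rpow_mul_besselJ (v : ℕ) {s : ℝ} (hs : -1 < s) (hs' : s < -(3 / 4)) :
    MeasureTheory.IntegrableOn (fun t : ℝ => t ^ s * besselJ (v + 1) t) (Set.Ioi 0) := by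
  obtain ⟨C, hC, hb⟩ := exists_abs_besselJ_succ_le_rpow v
  have hmeas : Measurable fun t : ℝ => t ^ s * besselJ (v + 1) t :=
    (measurable_id.pow_const s).mul (continuous_besselJ _).measurable
  rw [← Set.Ioc_union_Ioi_eq_Ioi zero_le_one]
  refine MeasureTheory.IntegrableOn.union ?_ ?_
  · have h1 : MeasureTheory.IntegrableOn (fun t : ℝ => t ^ s) (Set.Ioc 0 1) :=
      (intervalIntegrable_iff_integrableOn_Ioc_of_le zero_le_one).1
        (intervalIntegral.intervalIntegrable_rpow' hs)
    refine MeasureTheory.Integrable.mono' h1 hmeas.aestronglyMeasurable ?_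
    filter_upwards [MeasureTheory.ae_restrict_mem measurableSet_Ioc] with t ht
    rw [norm_mul, Real.norm_eq_abs, Real.norm_eq_abs, abs_of_nonneg (Real.rpow_nonneg ht.1.le _)]
    exact mul_le_of_le_one_right (Real.rpow_nonneg ht.1.le _) (abs_besselJ_le_one _ _)
  · have h1 : MeasureTheory.IntegrableOn (fun t : ℝ => t ^ (s - 1 / 4)) (Set.Ioi 1) :=
      integrableOn_Ioi_rpow_of_lt (by linarith) zero_lt_one
    refine MeasureTheory.Integrable.mono' (h1.const_mul C) hmeas.aestronglyMeasurable ?_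
    filter_upwards [MeasureTheory.ae_restrict_mem measurableSet_Ioi] with t ht
    have ht0 : 0 < t := zero_lt_one.trans ht
    rw [norm_mul, Real.norm_eq_abs, Real.norm_eq_abs, abs_of_nonneg (Real.rpow_nonneg ht0.le _)]
    calc t ^ s * |besselJ (v + 1) t| ≤ t ^ s * (C * t ^ (-(1 / 4) : ℝ)) := by
          gcongr
          exact hb t ht.le
      _ = C * t ^ (s - 1 / 4) := by
          rw [sub_eq_add_neg, Real.rpow_add ht0]
          ring

theorem integrableOn_besselJ_div (v : ℕ) :
    MeasureTheory.IntegrableOn (fun t : ℝ => besselJ (v + 1) t / t) (Set.Ioi 0) := by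
  have hmeas : Measurable fun t : ℝ => besselJ (v + 1) t / t :=
    (continuous_besselJ _).measurable.div measurable_id
  rw [← Set.Ioc_union_Ioi_eq_Ioi zero_le_one]
  refine MeasureTheory.IntegrableOn.union ?_ ?_
  · refine MeasureTheory.Integrable.mono' (g := fun _ => 1)
      (MeasureTheory.integrableOn_const (by simp)) hmeas.aestronglyMeasurable ?_
    filter_upwards [MeasureTheory.ae_restrict_mem measurableSet_Ioc] with t ht
    rw [besselJ_div_eq ht.1.ne', Real.norm_eq_abs, abs_div,
      abs_of_pos (by positivity : (0 : ℝ) < 2 * (v + 1)), div_le_one (by positivity)]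
    refine (abs_add_le _ _).trans ?_
    have : (0 : ℝ) ≤ v := v.cast_nonneg
    linarith [abs_besselJ_le_one v t, abs_besselJ_le_one (v + 2) t]
  · refine MeasureTheory.Integrable.mono' ((integrableOn_rpow_mul_besselJ v
      (s := -(7 / 8)) (by norm_num) (by norm_num)).mono_set
        (Set.Ioi_subset_Ioi zero_le_one)).norm hmeas.aestronglyMeasurable ?_
    filter_upwards [MeasureTheory.ae_restrict_mem measurableSet_Ioi] with t ht
    have ht0 : 0 < t := zero_lt_one.trans ht
    rw [norm_div, norm_mul, div_eq_mul_inv, mul_comm]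
    gcongr
    rw [Real.norm_eq_abs, Real.norm_eq_abs, abs_of_pos ht0, abs_of_nonneg (by positivity),
      ← Real.rpow_neg_one]
    exact Real.rpow_le_rpow_of_exponent_le ht.le (by norm_num)

theorem integral_sin_mul_besselJ_div (v : ℕ) {φ : ℝ} (h1 : -(Real.pi / 2) < φ)
    (h2 : φ < Real.pi / 2) :
    ∫ t in Set.Ioi (0 : ℝ), Real.sin (t * Real.sin φ) * (besselJ (v + 1) t / t) =
      Real.sin ((v + 1) * φ) / (v + 1) := by
  have hcos : 0 < Real.cos φ := Real.cos_pos_of_mem_Ioo ⟨h1, h2⟩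
  set w : ℂ := Complex.exp (φ * Complex.I) with hw
  have hw' : w = Real.cos φ + Real.sin φ * Complex.I := by
    rw [hw, Complex.exp_mul_I, Complex.ofReal_cos, Complex.ofReal_sin]
  have hwi : Complex.exp (-(φ * Complex.I)) = Real.cos φ - Real.sin φ * Complex.I := by
    rw [← neg_mul, Complex.exp_mul_I, Complex.ofReal_cos, Complex.ofReal_sin, Complex.cos_neg,
      Complex.sin_neg]
    ring
  have hw0 : w ≠ 0 := Complex.exp_ne_zero _
  have hww : w * (Real.cos φ - Real.sin φ * Complex.I) = 1 := by
    rw [← hwi, hw, ← Complex.exp_add, add_neg_cancel, Complex.exp_zero]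
  -- This is `p = (1/r - r)/2` at `r = ρ e^{iφ}`; its real part is positive for `0 < ρ < 1` because
  -- `cos φ > 0`.
  set P : ℝ → ℂ := fun ρ => ((ρ⁻¹ : ℝ) * (Real.cos φ - Real.sin φ * Complex.I) - ρ * w) / 2 with hP
  have hPre : ∀ ρ, (P ρ).re = (ρ⁻¹ - ρ) * Real.cos φ / 2 := by
    intro ρ
    have : P ρ = (((ρ⁻¹ - ρ) * Real.cos φ / 2 : ℝ) : ℂ) +
        ((-(ρ⁻¹ + ρ) * Real.sin φ / 2 : ℝ) : ℂ) * Complex.I := by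
      simp only [hP, hw']
      push_cast
      ring
    rw [this, Complex.add_re, Complex.re_ofReal_mul, Complex.I_re, Complex.ofReal_re]
    ring
  have hev : ∀ᶠ ρ : ℝ in nhdsWithin 1 (Set.Iio 1), 0 < ρ ∧ ρ < 1 :=
    Ioo_mem_nhdsLT zero_lt_one
  have hre : ∀ ρ : ℝ, 0 < ρ → ρ < 1 → 0 < (P ρ).re := by
    intro ρ h0 h1
    rw [hPre]
    have : 1 < ρ⁻¹ := (one_lt_inv₀ h0).2 h1
    have : 0 < ρ⁻¹ - ρ := by linarith
    positivity
  have hval : ∀ ρ : ℝ, 0 < ρ → ρ < 1 →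
      ∫ t in Set.Ioi (0 : ℝ), Complex.exp (-P ρ * t) * ((besselJ (v + 1) t / t : ℝ) : ℂ) =
        (ρ * w) ^ (v + 1) / (v + 1) := by
    intro ρ h0 h1
    have hρ : (ρ : ℂ) ≠ 0 := by exact_mod_cast h0.ne'
    refine laplace_besselJ_div (mul_ne_zero hρ hw0) ?_ (hre ρ h0 h1) ?_ v
    · rw [norm_mul, hw, Complex.norm_exp_ofReal_mul_I, mul_one, Complex.norm_real,
        Real.norm_eq_abs, abs_of_pos h0]
      exact h1
    · simp only [hP, Complex.ofReal_inv]
      field_simp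
      linear_combination hww
  have hPc : ContinuousAt P 1 := by
    have : ContinuousAt (fun ρ : ℝ => ρ⁻¹) 1 := continuousAt_inv₀ one_ne_zero
    have h3 : ContinuousAt (fun ρ : ℝ => ((ρ⁻¹ : ℝ) : ℂ)) 1 :=
      Complex.continuous_ofReal.continuousAt.comp this
    have h4 : ContinuousAt (fun ρ : ℝ => (ρ : ℂ)) 1 := Complex.continuous_ofReal.continuousAt
    exact ((h3.mul continuousAt_const).sub (h4.mul continuousAt_const)).div_const 2
  have hP1 : P 1 = -(Real.sin φ * Complex.I) := by
    simp only [hP, hw']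
    push_cast
    ring
  -- As `ρ → 1⁻` the exponential has modulus at most 1, so `|J_{v+1}(t)/t|` dominates.
  have hL : Filter.Tendsto
      (fun ρ : ℝ => ∫ t in Set.Ioi (0 : ℝ),
        Complex.exp (-P ρ * t) * ((besselJ (v + 1) t / t : ℝ) : ℂ))
      (nhdsWithin 1 (Set.Iio 1)) (nhds (∫ t in Set.Ioi (0 : ℝ),
        Complex.exp (-P 1 * t) * ((besselJ (v + 1) t / t : ℝ) : ℂ))) := by
    refine MeasureTheory.tendsto_integral_filter_of_dominated_convergence
      (fun t => ‖besselJ (v + 1) t / t‖) ?_ ?_ (integrableOn_besselJ_div v).norm ?_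
    · refine Filter.Eventually.of_forall fun ρ => Measurable.aestronglyMeasurable ?_
      refine Measurable.mul (by fun_prop) (Complex.measurable_ofReal.comp
        ((continuous_besselJ _).measurable.div measurable_id))
    · filter_upwards [hev] with ρ hρ
      filter_upwards [MeasureTheory.ae_restrict_mem measurableSet_Ioi] with t ht
      rw [norm_mul, Complex.norm_exp, Complex.norm_real]
      refine mul_le_of_le_one_left (norm_nonneg _) (Real.exp_le_one_iff.2 ?_)
      simp only [neg_mul, Complex.neg_re, Complex.mul_re, Complex.ofReal_re, Complex.ofReal_im,
        mul_zero, sub_zero]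
      have := mul_pos (hre ρ hρ.1 hρ.2) ht
      linarith
    · refine Filter.Eventually.of_forall fun t => ?_
      have : ContinuousAt (fun ρ : ℝ => Complex.exp (-P ρ * t) *
          ((besselJ (v + 1) t / t : ℝ) : ℂ)) 1 :=
        ((hPc.neg.mul continuousAt_const).cexp).mul continuousAt_const
      exact this.tendsto.mono_left nhdsWithin_le_nhds
  have hR : Filter.Tendsto (fun ρ : ℝ => ((ρ : ℂ) * w) ^ (v + 1) / ((v : ℂ) + 1))
      (nhdsWithin 1 (Set.Iio 1)) (nhds ((((1 : ℝ) : ℂ) * w) ^ (v + 1) / ((v : ℂ) + 1))) := by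
    have : Continuous fun ρ : ℝ => ((ρ : ℂ) * w) ^ (v + 1) / ((v : ℂ) + 1) := by fun_prop
    exact this.continuousAt.tendsto.mono_left nhdsWithin_le_nhds
  have hEq := tendsto_nhds_unique (hL.congr' (by
    filter_upwards [hev] with ρ hρ using hval ρ hρ.1 hρ.2)) hR
  have hint : MeasureTheory.IntegrableOn (fun t : ℝ => Complex.exp (-P 1 * t) *
      ((besselJ (v + 1) t / t : ℝ) : ℂ)) (Set.Ioi 0) := by
    refine MeasureTheory.Integrable.mono' (integrableOn_besselJ_div v).norm
      (Measurable.aestronglyMeasurable (Measurable.mul (by fun_prop) (Complex.measurable_ofReal.comp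
        ((continuous_besselJ _).measurable.div measurable_id))))
      (Filter.Eventually.of_forall fun t => ?_)
    rw [norm_mul, Complex.norm_exp, Complex.norm_real, hP1]
    simp
  have him := congrArg Complex.im hEq
  rw [← Complex.imCLM_apply, ← ContinuousLinearMap.integral_comp_comm _ hint] at him
  have e1 : ∀ t : ℝ, Complex.imCLM (Complex.exp (-P 1 * t) *
      ((besselJ (v + 1) t / t : ℝ) : ℂ)) = Real.sin (t * Real.sin φ) * (besselJ (v + 1) t / t) := by
    intro t
    rw [Complex.imCLM_apply, Complex.im_mul_ofReal, hP1,
      show -(-((Real.sin φ : ℂ) * Complex.I)) * (t : ℂ) =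
        ((t * Real.sin φ : ℝ) : ℂ) * Complex.I by push_cast; ring,
      Complex.exp_ofReal_mul_I_im]
  simp only [e1] at him
  rw [him, Complex.ofReal_one, one_mul, hw, ← Complex.exp_nat_mul,
    show ((v + 1 : ℕ) : ℂ) * (φ * Complex.I) = (((v + 1) * φ : ℝ) : ℂ) * Complex.I by
      push_cast; ring,
    show (v : ℂ) + 1 = (((v : ℝ) + 1 : ℝ) : ℂ) by push_cast; rfl, Complex.div_ofReal_im,
    Complex.exp_ofReal_mul_I_im]

/-! ### Reduction to the cotangent integral by Fubini. -/

theorem sinIntegral_eq_integral_sinc (x : ℝ) :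
    sinIntegral x = ∫ t in (0 : ℝ)..x, Real.sinc t := by
  refine intervalIntegral.integral_congr_ae ?_
  filter_upwards [(Set.countable_singleton (0 : ℝ)).ae_notMem MeasureTheory.volume] with t ht _
  rw [Real.sinc_of_ne_zero ht]

theorem sinIntegral_eq_integral_sinc_mul_sin (t : ℝ) :
    sinIntegral t =
      ∫ θ in Set.Ioo 0 (Real.pi / 2), t * (Real.sinc (t * Real.sin θ) * Real.cos θ) := by
  have h := intervalIntegral.integral_comp_mul_deriv (a := 0) (b := Real.pi / 2)
    (f := fun θ => t * Real.sin θ) (f' := fun θ => t * Real.cos θ) (g := Real.sinc)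
    (fun θ _ => (Real.hasDerivAt_sin θ).const_mul t)
    (Continuous.continuousOn (by fun_prop)) Real.continuous_sinc
  simp only [Real.sin_zero, mul_zero, Real.sin_pi_div_two, mul_one] at h
  rw [sinIntegral_eq_integral_sinc, ← h, intervalIntegral.integral_of_le (by positivity),
    MeasureTheory.integral_Ioc_eq_integral_Ioo]
  refine MeasureTheory.setIntegral_congr_fun measurableSet_Ioo fun θ _ => ?_
  simp only [Function.comp]
  ring

/-- Interpolates between `|sinc| ≤ 1` and `|sinc y| ≤ 1/y`, so that one power of `t sin θ` serves
both variables. -/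
theorem abs_sinc_le_rpow {y s : ℝ} (hy : 0 < y) (h1 : -1 ≤ s) (h2 : s ≤ 0) :
    |Real.sinc y| ≤ y ^ s := by
  rcases le_total y 1 with h | h
  · exact (Real.abs_sinc_le_one y).trans (Real.one_le_rpow_of_pos_of_le_one_of_nonpos hy h h2)
  · rw [Real.sinc_of_ne_zero hy.ne', abs_div, abs_of_pos hy]
    calc |Real.sin y| / y ≤ 1 / y := by
          gcongr
          exact Real.abs_sin_le_one y
      _ = y ^ (-1 : ℝ) := by rw [Real.rpow_neg_one, one_div]
      _ ≤ y ^ s := Real.rpow_le_rpow_of_exponent_le h h1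

/-- With `sin θ ≥ 2θ/π`, the integrand is dominated by a product: `t^{-7/8} |J_{v+1}(t)|` in `t` and
`(2θ/π)^{-7/8}` in `θ`, both integrable. -/
theorem integrable_sinc_mul_besselJ_prod (v : ℕ) :
    MeasureTheory.Integrable
      (Function.uncurry fun t θ : ℝ =>
        Real.sinc (t * Real.sin θ) * Real.cos θ * besselJ (v + 1) t)
      ((MeasureTheory.volume.restrict (Set.Ioi 0)).prod
        (MeasureTheory.volume.restrict (Set.Ioo 0 (Real.pi / 2)))) := by
  have i1 := (integrableOn_rpow_mul_besselJ v (s := -(7 / 8)) (by norm_num) (by norm_num)).norm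
  have i2 : MeasureTheory.IntegrableOn (fun θ : ℝ => (2 / Real.pi * θ) ^ (-(7 / 8) : ℝ))
      (Set.Ioo 0 (Real.pi / 2)) := by
    have h : MeasureTheory.IntegrableOn (fun θ : ℝ => θ ^ (-(7 / 8) : ℝ))
        (Set.Ioo 0 (Real.pi / 2)) :=
      ((intervalIntegrable_iff_integrableOn_Ioc_of_le (by positivity)).1
        (intervalIntegral.intervalIntegrable_rpow' (by norm_num))).mono_set Set.Ioo_subset_Ioc_self
    refine MeasureTheory.IntegrableOn.congr_fun
      (h.const_mul ((2 / Real.pi) ^ (-(7 / 8) : ℝ))) (fun θ hθ => ?_) measurableSet_Ioo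
    simp only [Real.mul_rpow (by positivity : 0 ≤ 2 / Real.pi) hθ.1.le]
  refine MeasureTheory.Integrable.mono' (MeasureTheory.Integrable.mul_prod i1 i2) ?_ ?_
  · have := continuous_besselJ (v + 1)
    refine Continuous.aestronglyMeasurable ?_
    simp only [Function.uncurry_def]
    fun_prop
  · rw [MeasureTheory.Measure.prod_restrict]
    filter_upwards [MeasureTheory.ae_restrict_mem (measurableSet_Ioi.prod measurableSet_Ioo)]
      with ⟨t, θ⟩ ⟨ht, hθ⟩
    have ht0 : 0 < t := ht
    have hθ0 : 0 < θ := hθ.1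
    have hsin : 2 / Real.pi * θ ≤ Real.sin θ := Real.mul_le_sin hθ0.le hθ.2.le
    have hlow : 0 < t * (2 / Real.pi * θ) := by positivity
    have hle : t * (2 / Real.pi * θ) ≤ t * Real.sin θ := by gcongr
    simp only [Function.uncurry_apply_pair]
    rw [norm_mul, norm_mul, norm_mul, Real.norm_eq_abs, Real.norm_eq_abs (Real.cos θ),
      Real.norm_of_nonneg (Real.rpow_nonneg ht0.le _)]
    have b1 : |Real.sinc (t * Real.sin θ)| ≤
        t ^ (-(7 / 8) : ℝ) * (2 / Real.pi * θ) ^ (-(7 / 8) : ℝ) := by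
      rw [← Real.mul_rpow ht0.le (by positivity)]
      exact (abs_sinc_le_rpow (hlow.trans_le hle) (by norm_num) (by norm_num)).trans
        (Real.rpow_le_rpow_of_nonpos hlow hle (by norm_num))
    calc |Real.sinc (t * Real.sin θ)| * |Real.cos θ| * ‖besselJ (v + 1) t‖
        ≤ t ^ (-(7 / 8) : ℝ) * (2 / Real.pi * θ) ^ (-(7 / 8) : ℝ) * 1 * ‖besselJ (v + 1) t‖ := by
          gcongr
          exact Real.abs_cos_le_one θ
      _ = _ := by ring

theorem sinIntegral_mul_besselJ_div_eq {t : ℝ} (ht : t ≠ 0) (v : ℕ) :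
    sinIntegral t * besselJ v t / t = ∫ θ in Set.Ioo 0 (Real.pi / 2),
      Real.sinc (t * Real.sin θ) * Real.cos θ * besselJ v t := by
  rw [sinIntegral_eq_integral_sinc_mul_sin, MeasureTheory.integral_const_mul,
    MeasureTheory.integral_mul_const]
  field_simp

theorem integrableOn_sinIntegral_mul_besselJ_div (v : ℕ) :
    MeasureTheory.IntegrableOn (fun t : ℝ => sinIntegral t * besselJ (v + 1) t / t)
      (Set.Ioi 0) := by
  refine MeasureTheory.IntegrableOn.congr_fun
    (MeasureTheory.Integrable.integral_prod_left (integrable_sinc_mul_besselJ_prod v))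
    (fun t ht => ?_) measurableSet_Ioi
  exact (sinIntegral_mul_besselJ_div_eq (ne_of_gt ht) _).symm

theorem integral_sinIntegral_mul_besselJ_div (v : ℕ) :
    ∫ t in Set.Ioi (0 : ℝ), sinIntegral t * besselJ (v + 1) t / t =
      1 / ((v : ℝ) + 1) *
        ∫ θ in (0 : ℝ)..(Real.pi / 2), Real.sin (((v : ℝ) + 1) * θ) * Real.cot θ := by
  rw [MeasureTheory.setIntegral_congr_fun measurableSet_Ioi
    fun t ht => sinIntegral_mul_besselJ_div_eq (ne_of_gt ht) (v + 1),
    MeasureTheory.integral_integral_swap (integrable_sinc_mul_besselJ_prod v),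
    ← intervalIntegral.integral_const_mul, intervalIntegral.integral_of_le (by positivity),
    MeasureTheory.integral_Ioc_eq_integral_Ioo]
  refine MeasureTheory.setIntegral_congr_fun measurableSet_Ioo fun θ hθ => ?_
  have hsin : 0 < Real.sin θ := Real.sin_pos_of_pos_of_lt_pi hθ.1 (by linarith [hθ.2, Real.pi_pos])
  have e : ∫ t in Set.Ioi (0 : ℝ), Real.sinc (t * Real.sin θ) * Real.cos θ * besselJ (v + 1) t =
      ∫ t in Set.Ioi (0 : ℝ),
        Real.cot θ * (Real.sin (t * Real.sin θ) * (besselJ (v + 1) t / t)) := by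
    refine MeasureTheory.setIntegral_congr_fun measurableSet_Ioi fun t ht => ?_
    have ht0 : t ≠ 0 := ne_of_gt ht
    simp only [Real.sinc_of_ne_zero (mul_ne_zero ht0 hsin.ne'), Real.cot_eq_cos_div_sin]
    field_simp
  simp only [e, MeasureTheory.integral_const_mul]
  rw [integral_sin_mul_besselJ_div v (by linarith [hθ.1, Real.pi_pos]) hθ.2]
  ring

/-! ### Expansion of `sin ((2n+1)θ)` in powers of `sin θ`. -/

/-- The product `∏_{j=1}^k (y + j) (y - j + 1)`, which is `(n + k)! / (n - k)!` at `y = n ≥ k`. -/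
noncomputable def centralProd (y : ℝ) : ℕ → ℝ
  | 0 => 1
  | k + 1 => centralProd y k * ((y + k + 1) * (y - k))

theorem centralProd_add_one (y : ℝ) (k : ℕ) :
    centralProd (y + 1) (k + 1) = (y + k + 2) * (y + k + 1) * centralProd y k := by
  induction k with
  | zero => simp only [centralProd, Nat.cast_zero]; ring
  | succ k ih =>
    rw [centralProd, ih, centralProd]
    push_cast
    ring

theorem centralProd_sub_one (y : ℝ) (k : ℕ) :
    centralProd (y - 1) (k + 1) = (y - k - 1) * (y - k) * centralProd y k := by
  induction k with
  | zero => simp [centralProd]; ring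
  | succ k ih =>
    rw [centralProd, ih, centralProd]
    push_cast
    ring

theorem centralProd_eq_zero {n k : ℕ} (h : n < k) : centralProd n k = 0 := by
  induction k with
  | zero => omega
  | succ k ih =>
    rw [centralProd]
    rcases Nat.lt_or_ge n k with h' | h'
    · rw [ih h', zero_mul]
    · obtain rfl : n = k := by omega
      simp

theorem centralProd_eq_factorial {n k : ℕ} (h : k ≤ n) :
    centralProd n k = ((n + k).factorial : ℝ) / ((n - k).factorial : ℝ) := by
  induction k with
  | zero =>
    have : (n.factorial : ℝ) ≠ 0 := by exact_mod_cast n.factorial_ne_zero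
    simp [centralProd, this]
  | succ k ih =>
    rw [centralProd, ih (by omega)]
    obtain ⟨m, rfl⟩ : ∃ m, n = m + k + 1 := ⟨n - k - 1, by omega⟩
    rw [show m + k + 1 - k = m + 1 by omega, show m + k + 1 - (k + 1) = m by omega,
      show m + k + 1 + (k + 1) = (m + k + 1 + k) + 1 by ring, Nat.factorial_succ (m + k + 1 + k),
      Nat.factorial_succ m]
    have : (m.factorial : ℝ) ≠ 0 := by exact_mod_cast m.factorial_ne_zero
    have h2 : (m : ℝ) + 1 ≠ 0 := by positivity
    push_cast
    field_simp
    ring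

/-- This is the coefficient identity behind `sin ((2n+3)θ) = (2 - 4 sin² θ) sin ((2n+1)θ) - sin
((2n-1)θ)`. -/
theorem centralProd_rec (y : ℝ) (k : ℕ) :
    (2 * y + 3) * centralProd (y + 1) (k + 1) + (2 * y - 1) * centralProd (y - 1) (k + 1) =
      2 * (2 * y + 1) * centralProd y (k + 1) +
        (2 * y + 1) * (2 * k + 3) * (2 * k + 2) * centralProd y k := by
  rw [centralProd_add_one, centralProd_sub_one, centralProd]
  ring

/-- The coefficients vanish for `k > n`, so any cutoff `N > n` is allowed; three consecutive values
of `n` can then share one range in the induction. -/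
theorem sin_odd_mul_eq_sum (n : ℕ) (θ : ℝ) : ∀ N : ℕ, n < N →
    Real.sin ((2 * (n : ℝ) + 1) * θ) = (2 * (n : ℝ) + 1) * ∑ k ∈ Finset.range N,
      centralProd n k * ((-4) ^ k / ((2 * k + 1).factorial : ℝ)) * Real.sin θ ^ (2 * k + 1) := by
  have step : ∀ (y : ℝ) (k : ℕ),
      (2 * (y + 1) + 1) * (centralProd (y + 1) (k + 1) *
        ((-4) ^ (k + 1) / ((2 * (k + 1) + 1).factorial : ℝ)) * Real.sin θ ^ (2 * (k + 1) + 1)) =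
      2 * ((2 * y + 1) * (centralProd y (k + 1) *
        ((-4) ^ (k + 1) / ((2 * (k + 1) + 1).factorial : ℝ)) * Real.sin θ ^ (2 * (k + 1) + 1))) -
      4 * Real.sin θ ^ 2 * ((2 * y + 1) * (centralProd y k *
        ((-4) ^ k / ((2 * k + 1).factorial : ℝ)) * Real.sin θ ^ (2 * k + 1))) -
      (2 * (y - 1) + 1) * (centralProd (y - 1) (k + 1) *
        ((-4) ^ (k + 1) / ((2 * (k + 1) + 1).factorial : ℝ)) * Real.sin θ ^ (2 * (k + 1) + 1)) := by
    intro y k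
    have h := centralProd_rec y k
    rw [show 2 * (k + 1) + 1 = 2 * k + 1 + 1 + 1 by ring, Nat.factorial_succ (2 * k + 1 + 1),
      Nat.factorial_succ (2 * k + 1)]
    have h1 : ((2 * k + 1).factorial : ℝ) ≠ 0 := by exact_mod_cast Nat.factorial_ne_zero _
    have h2 : (2 : ℝ) * k + 1 + 1 ≠ 0 := by positivity
    have h3 : (2 : ℝ) * k + 1 + 1 + 1 ≠ 0 := by positivity
    push_cast
    field_simp
    linear_combination (-4) ^ (k + 1) * Real.sin θ ^ (2 * k + 1 + 1 + 1) * h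
  -- `A` is expanded at two cutoffs because the factor `sin² θ` raises each power by one index.
  -- Taking `y` real avoids truncated subtraction in `y - 1`.
  have key : ∀ (y : ℝ) (M : ℕ) (A B C : ℝ),
      A = (2 * y + 1) * ∑ k ∈ Finset.range (M + 1), centralProd y k *
        ((-4) ^ k / ((2 * k + 1).factorial : ℝ)) * Real.sin θ ^ (2 * k + 1) →
      A = (2 * y + 1) * ∑ k ∈ Finset.range M, centralProd y k *
        ((-4) ^ k / ((2 * k + 1).factorial : ℝ)) * Real.sin θ ^ (2 * k + 1) →
      B = (2 * (y - 1) + 1) * ∑ k ∈ Finset.range (M + 1), centralProd (y - 1) k *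
        ((-4) ^ k / ((2 * k + 1).factorial : ℝ)) * Real.sin θ ^ (2 * k + 1) →
      C = (2 - 4 * Real.sin θ ^ 2) * A - B →
      C = (2 * (y + 1) + 1) * ∑ k ∈ Finset.range (M + 1), centralProd (y + 1) k *
        ((-4) ^ k / ((2 * k + 1).factorial : ℝ)) * Real.sin θ ^ (2 * k + 1) := by
    intro y M A B C h1 h2 h3 h4
    have h5 : C = 2 * A - 4 * Real.sin θ ^ 2 * A - B := by rw [h4]; ring
    rw [h5]
    nth_rewrite 1 [h1]
    rw [h2, h3]
    have hs : (2 * (y + 1) + 1) * ∑ k ∈ Finset.range M, centralProd (y + 1) (k + 1) *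
        ((-4) ^ (k + 1) / ((2 * (k + 1) + 1).factorial : ℝ)) * Real.sin θ ^ (2 * (k + 1) + 1) =
        2 * ((2 * y + 1) * ∑ k ∈ Finset.range M, centralProd y (k + 1) *
        ((-4) ^ (k + 1) / ((2 * (k + 1) + 1).factorial : ℝ)) * Real.sin θ ^ (2 * (k + 1) + 1)) -
        4 * Real.sin θ ^ 2 * ((2 * y + 1) * ∑ k ∈ Finset.range M, centralProd y k *
        ((-4) ^ k / ((2 * k + 1).factorial : ℝ)) * Real.sin θ ^ (2 * k + 1)) -
        (2 * (y - 1) + 1) * ∑ k ∈ Finset.range M, centralProd (y - 1) (k + 1) *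
        ((-4) ^ (k + 1) / ((2 * (k + 1) + 1).factorial : ℝ)) * Real.sin θ ^ (2 * (k + 1) + 1) := by
      simp only [Finset.mul_sum, ← Finset.sum_sub_distrib]
      exact Finset.sum_congr rfl fun k _ => step y k
    rw [Finset.sum_range_succ', Finset.sum_range_succ', Finset.sum_range_succ']
    simp only [centralProd, mul_zero, zero_add, pow_zero, Nat.factorial_one, Nat.cast_one, pow_one,
      div_one, mul_one] at hs ⊢
    linear_combination -hs

  induction n using Nat.twoStepInduction with
  | zero =>
    intro N hN
    rw [Finset.sum_eq_single_of_mem 0 (Finset.mem_range.2 hN)]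
    · simp [centralProd]
    · intro k _ hk
      rw [centralProd_eq_zero (Nat.pos_of_ne_zero hk)]
      ring
  | one =>
    intro N hN
    have hsub : Finset.range 2 ⊆ Finset.range N := Finset.range_subset_range.2 (by omega)
    rw [← Finset.sum_subset hsub]
    · rw [Finset.sum_range_succ, Finset.sum_range_one]
      norm_num [centralProd, Nat.factorial]
      rw [Real.sin_three_mul]
      ring
    · intro k _ hk
      rw [centralProd_eq_zero (by simpa using hk)]
      ring
  | more n ih0 ih1 =>
    intro N hN
    obtain ⟨M, rfl⟩ : ∃ M, N = M + 1 := ⟨N - 1, by omega⟩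
    have hy : ((n + 1 : ℕ) : ℝ) - 1 = n := by push_cast; ring
    have hy' : ((n + 1 : ℕ) : ℝ) + 1 = ((n + 2 : ℕ) : ℝ) := by push_cast; ring
    have := key ((n + 1 : ℕ) : ℝ) M _ (Real.sin ((2 * (n : ℝ) + 1) * θ))
      (Real.sin ((2 * ((n + 2 : ℕ) : ℝ) + 1) * θ)) (ih1 (M + 1) (by omega)) (ih1 M (by omega))
      (by rw [hy]; exact ih0 (M + 1) (by omega)) ?_
    · rw [hy'] at this
      exact this
    · have e1 : (2 * ((n + 2 : ℕ) : ℝ) + 1) * θ = (2 * ((n + 1 : ℕ) : ℝ) + 1) * θ + 2 * θ := by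
        push_cast; ring
      have e2 : (2 * (n : ℝ) + 1) * θ = (2 * ((n + 1 : ℕ) : ℝ) + 1) * θ - 2 * θ := by
        push_cast; ring
      rw [e1, e2, Real.sin_add, Real.sin_sub, Real.cos_two_mul, Real.cos_sq']
      ring

/-- Every power of `sin θ` in the expansion is odd, so one factor cancels the denominator of `cot`
and the right side is continuous through `0`. -/
theorem sin_odd_mul_mul_cot (n : ℕ) {θ : ℝ} (h : Real.sin θ ≠ 0) :
    Real.sin ((2 * (n : ℝ) + 1) * θ) * Real.cot θ =
      (2 * (n : ℝ) + 1) * ∑ k ∈ Finset.range (n + 1),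
        centralProd n k * ((-4) ^ k / ((2 * k + 1).factorial : ℝ)) *
          (Real.sin θ ^ (2 * k) * Real.cos θ) := by
  rw [sin_odd_mul_eq_sum n θ (n + 1) n.lt_succ_self, Real.cot_eq_cos_div_sin, mul_assoc,
    Finset.sum_mul]
  congr 1
  refine Finset.sum_congr rfl fun k _ => ?_
  rw [pow_succ]
  field_simp

/-! ### Two evaluations of the cotangent integral. -/

theorem sin_ne_zero_of_mem_uIoc {θ : ℝ} (h : θ ∈ Set.uIoc 0 (Real.pi / 2)) : Real.sin θ ≠ 0 := by
  rw [Set.uIoc_of_le (by positivity)] at h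
  exact (Real.sin_pos_of_pos_of_lt_pi h.1 (by linarith [h.2, Real.pi_pos])).ne'

theorem intervalIntegrable_sin_odd_mul_mul_cot (n : ℕ) :
    IntervalIntegrable (fun t : ℝ => Real.sin ((2 * (n : ℝ) + 1) * t) * Real.cot t)
      MeasureTheory.volume 0 (Real.pi / 2) := by
  have hc : Continuous fun θ : ℝ => (2 * (n : ℝ) + 1) * ∑ k ∈ Finset.range (n + 1),
        centralProd n k * ((-4) ^ k / ((2 * k + 1).factorial : ℝ)) *
          (Real.sin θ ^ (2 * k) * Real.cos θ) := by fun_prop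
  exact (hc.intervalIntegrable 0 (Real.pi / 2)).congr
    fun θ hθ => (sin_odd_mul_mul_cot n (sin_ne_zero_of_mem_uIoc hθ)).symm

theorem integral_sin_odd_mul_mul_cot_eq_sum (n : ℕ) :
    ∫ t in (0 : ℝ)..(Real.pi / 2), Real.sin ((2 * (n : ℝ) + 1) * t) * Real.cot t =
      (2 * (n : ℝ) + 1) * ∑ k ∈ Finset.range (n + 1),
        centralProd n k * ((-4) ^ k / ((2 * k + 1).factorial : ℝ)) * (1 / (2 * k + 1)) := by
  rw [intervalIntegral.integral_congr_ae (MeasureTheory.ae_of_all _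
    fun θ hθ => sin_odd_mul_mul_cot n (sin_ne_zero_of_mem_uIoc hθ)),
    intervalIntegral.integral_const_mul, intervalIntegral.integral_finsetSum
      fun k _ => Continuous.intervalIntegrable (by fun_prop) _ _]
  congr 1
  refine Finset.sum_congr rfl fun k _ => ?_
  rw [intervalIntegral.integral_const_mul]
  have h := intervalIntegral.integral_comp_mul_deriv (a := 0) (b := Real.pi / 2)
    (f := Real.sin) (f' := Real.cos) (g := fun x => x ^ (2 * k))
    (fun θ _ => Real.hasDerivAt_sin θ) Real.continuous_cos.continuousOn (by fun_prop)
  simp only [Function.comp, Real.sin_zero, Real.sin_pi_div_two, integral_pow] at h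
  rw [h]
  simp

theorem neumannAlpha_succ (n : ℕ) :
    neumannAlpha (n + 1) =
      neumannAlpha n + (-1) ^ (n + 1) / (2 * (n : ℝ) + 3) + (-1) ^ n / (2 * (n : ℝ) + 1) := by
  unfold neumannAlpha
  rw [Finset.sum_Icc_succ_top (by omega)]
  push_cast
  rw [show (2 : ℝ) * (n + 1) - 1 = 2 * n + 1 by ring,
    show (2 : ℝ) * (n + 1) + 1 = 2 * n + 3 by ring]
  ring

theorem neumannAlpha_zero : neumannAlpha 0 = 1 := by
  simp [neumannAlpha]

theorem integral_cos_nat_mul {m : ℕ} (hm : m ≠ 0) :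
    ∫ t in (0 : ℝ)..(Real.pi / 2), Real.cos (m * t) = Real.sin (m * (Real.pi / 2)) / m := by
  have hm' : (m : ℝ) ≠ 0 := by exact_mod_cast hm
  rw [intervalIntegral.integral_comp_mul_left _ hm', integral_cos]
  simp [div_eq_inv_mul]

theorem sin_odd_mul_pi_div_two (n : ℕ) : Real.sin ((2 * n + 1) * (Real.pi / 2)) = (-1) ^ n := by
  rw [show (2 * (n : ℝ) + 1) * (Real.pi / 2) = n * Real.pi + Real.pi / 2 by ring,
    Real.sin_add_pi_div_two, Real.cos_nat_mul_pi]

/-- Successive integrands differ by `2 cos ((2n+2)t) cos t = cos ((2n+3)t) + cos ((2n+1)t)`, whose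
integral is the increment of `α_n`. -/
theorem integral_sin_odd_mul_mul_cot (n : ℕ) :
    ∫ t in (0 : ℝ)..(Real.pi / 2), Real.sin ((2 * (n : ℝ) + 1) * t) * Real.cot t =
      neumannAlpha n := by
  induction n with
  | zero =>
    rw [integral_sin_odd_mul_mul_cot_eq_sum]
    simp [centralProd, neumannAlpha_zero]
  | succ n ih =>
    have hi := intervalIntegrable_sin_odd_mul_mul_cot n
    have e : ∀ t ∈ Set.uIoc 0 (Real.pi / 2),
        Real.sin ((2 * ((n + 1 : ℕ) : ℝ) + 1) * t) * Real.cot t =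
          Real.sin ((2 * (n : ℝ) + 1) * t) * Real.cot t +
            (Real.cos (((2 * n + 3 : ℕ) : ℝ) * t) + Real.cos (((2 * n + 1 : ℕ) : ℝ) * t)) := by
      intro t ht
      have hs := sin_ne_zero_of_mem_uIoc ht
      have e1 : (2 * ((n + 1 : ℕ) : ℝ) + 1) * t = 2 * (n + 1) * t + t := by push_cast; ring
      have e2 : (2 * (n : ℝ) + 1) * t = 2 * (n + 1) * t - t := by ring
      have e3 : ((2 * n + 3 : ℕ) : ℝ) * t = 2 * (n + 1) * t + t := by push_cast; ring
      have e4 : ((2 * n + 1 : ℕ) : ℝ) * t = 2 * (n + 1) * t - t := by push_cast; ring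
      rw [e1, e2, e3, e4, Real.sin_add, Real.sin_sub, Real.cos_add, Real.cos_sub,
        Real.cot_eq_cos_div_sin]
      field_simp
      ring
    rw [intervalIntegral.integral_congr_ae (MeasureTheory.ae_of_all _ e),
      intervalIntegral.integral_add hi (Continuous.intervalIntegrable (by fun_prop) _ _),
      intervalIntegral.integral_add (Continuous.intervalIntegrable (by fun_prop) _ _)
        (Continuous.intervalIntegrable (by fun_prop) _ _), ih,
      integral_cos_nat_mul (by omega), integral_cos_nat_mul (by omega), neumannAlpha_succ]
    have s1 := sin_odd_mul_pi_div_two n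
    have s2 := sin_odd_mul_pi_div_two (n + 1)
    push_cast at s2 ⊢
    rw [show (2 : ℝ) * (n + 1) + 1 = 2 * n + 3 by ring] at s2
    rw [s1, s2]
    ring

/-! ### Neumann series. -/

/-- The factor `2^{-(e+2n)}` in the power bound for `J_{e+2n}` absorbs `4^n`, so this crude growth
condition covers all the coefficients needed. -/
theorem norm_mul_besselJ_le {a y R : ℝ} {n : ℕ} (ha : |a| ≤ 4 ^ n) (hy : |y| ≤ R) (e : ℕ) :
    ‖a * besselJ (e + 2 * n) y‖ ≤
      R ^ (e + 2 * n) / (e + 2 * n).factorial * Real.exp ((R / 2) ^ 2) := by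
  have hR : 0 ≤ R := (abs_nonneg y).trans hy
  rw [norm_mul, Real.norm_eq_abs, Real.norm_eq_abs]
  have h4 : (4 : ℝ) ^ n * (R / 2) ^ (e + 2 * n) ≤ R ^ (e + 2 * n) := by
    have h2 : (4 : ℝ) ^ n ≤ 2 ^ (e + 2 * n) := by
      rw [pow_add, pow_mul]
      norm_num
      exact one_le_pow₀ one_le_two
    rw [div_pow, mul_div_assoc', div_le_iff₀ (by positivity), mul_comm]
    gcongr
  calc |a| * |besselJ (e + 2 * n) y|
      ≤ 4 ^ n * ((|y| / 2) ^ (e + 2 * n) / (e + 2 * n).factorial * Real.exp ((|y| / 2) ^ 2)) := by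
        gcongr
        exact abs_besselJ_le_pow _ _
    _ ≤ 4 ^ n * ((R / 2) ^ (e + 2 * n) / (e + 2 * n).factorial * Real.exp ((R / 2) ^ 2)) := by
        gcongr
    _ = 4 ^ n * (R / 2) ^ (e + 2 * n) / (e + 2 * n).factorial * Real.exp ((R / 2) ^ 2) := by ring
    _ ≤ _ := by gcongr

theorem summable_pow_div_factorial_step (e : ℕ) (R c : ℝ) :
    Summable fun n : ℕ => R ^ (e + 2 * n) / (e + 2 * n).factorial * c :=
  ((Real.summable_pow_div_factorial R).comp_injective
    (i := fun n : ℕ => e + 2 * n) fun m n h => by simpa using h).mul_right c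

theorem summable_mul_besselJ {a : ℕ → ℝ} (ha : ∀ n, |a n| ≤ 4 ^ n) (e : ℕ) (x : ℝ) :
    Summable fun n => a n * besselJ (e + 2 * n) x :=
  .of_norm_bounded (summable_pow_div_factorial_step e |x| _)
    fun n => norm_mul_besselJ_le (ha n) le_rfl e

theorem hasDerivAt_tsum_mul_besselJ {a : ℕ → ℝ} (ha : ∀ n, |a n| ≤ 4 ^ n) (e : ℕ) (x : ℝ) :
    HasDerivAt (fun y => ∑' n, a n * besselJ (e + 1 + 2 * n) y)
      ((∑' n, a n * besselJ (e + 2 * n) x - ∑' n, a n * besselJ (e + 2 + 2 * n) x) / 2) x := by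
  set R : ℝ := |x| + 1 with hR
  have hx : |x| < R := by linarith
  have hR0 : 0 < R := (abs_nonneg x).trans_lt hx
  have key := hasDerivAt_tsum_of_isPreconnected (𝕜 := ℝ) (t := Metric.ball (0 : ℝ) R)
    (g := fun (n : ℕ) (y : ℝ) => a n * besselJ (e + 1 + 2 * n) y)
    (g' := fun (n : ℕ) (y : ℝ) =>
      (a n * besselJ (e + 2 * n) y - a n * besselJ (e + 2 + 2 * n) y) / 2)
    (y₀ := 0) (y := x)
    (((summable_pow_div_factorial_step e R (Real.exp ((R / 2) ^ 2))).add
      (summable_pow_div_factorial_step (e + 2) R (Real.exp ((R / 2) ^ 2)))).div_const 2)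
    Metric.isOpen_ball (convex_ball _ _).isPreconnected
    (fun n y _ => by
      rw [show e + 1 + 2 * n = e + 2 * n + 1 by ring, show e + 2 + 2 * n = e + 2 * n + 2 by ring]
      refine ((hasDerivAt_besselJ_succ (e + 2 * n) y).const_mul (a n)).congr_deriv ?_
      ring)
    (fun n y hy => by
      have hy' : |y| ≤ R := by
        rw [Metric.mem_ball, dist_zero_right, Real.norm_eq_abs] at hy
        exact hy.le
      rw [norm_div, Real.norm_two]
      gcongr
      exact (norm_sub_le _ _).trans
        (add_le_add (norm_mul_besselJ_le (ha n) hy' e) (norm_mul_besselJ_le (ha n) hy' (e + 2))))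
    (Metric.mem_ball_self hR0) (summable_mul_besselJ ha (e + 1) 0)
    (by rw [Metric.mem_ball, dist_zero_right, Real.norm_eq_abs]; exact hx)
  refine key.congr_deriv ?_
  rw [tsum_div_const,
    (summable_mul_besselJ ha e x).tsum_sub (summable_mul_besselJ ha (e + 2) x)]

theorem tsum_mul_besselJ_eq_zero_add {a : ℕ → ℝ} (ha : ∀ n, |a n| ≤ 4 ^ n) (e : ℕ) (x : ℝ) :
    ∑' n, a n * besselJ (e + 2 * n) x =
      a 0 * besselJ e x + ∑' n, a (n + 1) * besselJ (e + 2 + 2 * n) x := by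
  rw [(summable_mul_besselJ ha e x).tsum_eq_zero_add]
  simp only [mul_zero, add_zero, mul_add, mul_one]
  congr 1
  refine tsum_congr fun n => ?_
  rw [show e + (2 * n + 2) = e + 2 + 2 * n by ring]

/-- With `S = ∑ (-1)^n J_{2n+1}` and `T = ∑ (-1)^n J_{2n+2}`, the pair `(2S, J_0 - 2T)` solves the
differential system of `(sin, cos)` with the same initial values. -/
theorem sin_eq_tsum_besselJ (x : ℝ) :
    2 * ∑' n : ℕ, (-1) ^ n * besselJ (1 + 2 * n) x = Real.sin x := by
  have ha : ∀ n : ℕ, |(-1 : ℝ) ^ n| ≤ 4 ^ n := fun n => by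
    rw [abs_pow, abs_neg, abs_one, one_pow]
    exact one_le_pow₀ (by norm_num)
  set S : ℝ → ℝ := fun y => ∑' n : ℕ, (-1) ^ n * besselJ (0 + 1 + 2 * n) y with hS
  set T : ℝ → ℝ := fun y => ∑' n : ℕ, (-1) ^ n * besselJ (1 + 1 + 2 * n) y with hT
  have hshift : ∀ (e : ℕ) (y : ℝ), ∑' n : ℕ, (-1) ^ n * besselJ (e + 2 * n) y =
      besselJ e y - ∑' n : ℕ, (-1) ^ n * besselJ (e + 2 + 2 * n) y := by
    intro e y
    rw [tsum_mul_besselJ_eq_zero_add ha e y, pow_zero, one_mul, sub_eq_add_neg, ← tsum_neg]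
    congr 1
    exact tsum_congr fun n => by ring
  have hS' : ∀ y, HasDerivAt S ((besselJ 0 y - 2 * T y) / 2) y := by
    intro y
    refine (hasDerivAt_tsum_mul_besselJ ha 0 y).congr_deriv ?_
    rw [hshift 0 y]
    simp only [hT, zero_add, Nat.reduceAdd]
    ring
  have hT' : ∀ y, HasDerivAt T ((2 * S y - besselJ 1 y) / 2) y := by
    intro y
    refine (hasDerivAt_tsum_mul_besselJ ha 1 y).congr_deriv ?_
    have := hshift 1 y
    simp only [hS, zero_add]
    linear_combination -this / 2
  -- The squared distance between the two solutions is conserved, and it is zero at `0`.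
  have hE : ∀ y, HasDerivAt (fun y => (2 * S y - Real.sin y) ^ 2 +
      (besselJ 0 y - 2 * T y - Real.cos y) ^ 2) 0 y := by
    intro y
    refine (((((hS' y).const_mul 2).fun_sub (Real.hasDerivAt_sin y)).fun_pow 2).fun_add
      ((((hasDerivAt_besselJ_zero y).fun_sub ((hT' y).const_mul 2)).fun_sub
        (Real.hasDerivAt_cos y)).fun_pow 2)).congr_deriv ?_
    push_cast
    ring
  have hconst := is_const_of_deriv_eq_zero (fun y => (hE y).differentiableAt)
    (fun y => (hE y).deriv) x 0
  have hS0 : S 0 = 0 := by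
    simp only [hS, show ∀ n, 0 + 1 + 2 * n = 2 * n + 1 by intro n; ring, besselJ_succ_zero,
      mul_zero, tsum_zero]
  have hT0 : T 0 = 0 := by
    simp only [hT, show ∀ n, 1 + 1 + 2 * n = 2 * n + 1 + 1 by intro n; ring, besselJ_succ_zero,
      mul_zero, tsum_zero]
  simp only [hS0, hT0, besselJ_zero_zero, Real.sin_zero, Real.cos_zero, mul_zero, sub_zero,
    sub_self, ne_eq, OfNat.ofNat_ne_zero, not_false_eq_true, zero_pow, add_zero] at hconst
  have h0 : (2 * S x - Real.sin x) ^ 2 = 0 := by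
    nlinarith [sq_nonneg (2 * S x - Real.sin x),
      sq_nonneg (besselJ 0 x - 2 * T x - Real.cos x)]
  have := pow_eq_zero_iff two_ne_zero |>.1 h0
  simp only [hS, zero_add] at this
  linarith

theorem abs_neumannAlpha_le (n : ℕ) : |neumannAlpha n| ≤ 4 ^ n := by
  induction n with
  | zero => simp [neumannAlpha_zero]
  | succ n ih =>
    cases n with
    | zero =>
      rw [neumannAlpha_succ, neumannAlpha_zero]
      norm_num [abs_of_pos]
    | succ n =>
      rw [neumannAlpha_succ]
      refine (abs_add_three _ _ _).trans ?_
      have h : ∀ (k : ℕ) (c : ℝ), 1 ≤ c → |(-1 : ℝ) ^ k / c| ≤ 1 := by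
        intro k c hc
        rw [abs_div, abs_pow, abs_neg, abs_one, one_pow, abs_of_pos (by linarith)]
        exact div_le_one_of_le₀ hc (by linarith)
      have hn : (0 : ℝ) ≤ ((n + 1 : ℕ) : ℝ) := Nat.cast_nonneg _
      have h1 := h (n + 1 + 1) (2 * ((n + 1 : ℕ) : ℝ) + 3) (by linarith)
      have h2 := h (n + 1) (2 * ((n + 1 : ℕ) : ℝ) + 1) (by linarith)
      have h3 : (1 : ℝ) ≤ 4 ^ (n + 1) := one_le_pow₀ (by norm_num)
      rw [pow_succ (4 : ℝ) (n + 1)]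
      linarith

/-- Summation by parts: with `c_n = (-1)^n/(2n+1)` and `α_0 = c_0 = 1`, the left side becomes `∑ c_n
(J_{2n} + J_{2n+2})`. The factor `2(2n+1)/x` from the Bessel recurrence cancels the denominators of
`c_n`, leaving the series of `sin x / x`. -/
theorem tsum_neumannAlpha_mul_besselJ_sub (x : ℝ) :
    ∑' n, neumannAlpha n * besselJ (0 + 2 * n) x -
      ∑' n, neumannAlpha n * besselJ (0 + 2 + 2 * n) x = Real.sinc x := by
  have hc : ∀ n : ℕ, |(-1 : ℝ) ^ n / (2 * n + 1)| ≤ 4 ^ n := by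
    intro n
    have h1 : (1 : ℝ) ≤ 2 * n + 1 := by linarith [(n.cast_nonneg : (0 : ℝ) ≤ n)]
    rw [abs_div, abs_pow, abs_neg, abs_one, one_pow, abs_of_pos (by linarith)]
    exact (div_le_one_of_le₀ h1 (by linarith)).trans (one_le_pow₀ (by norm_num))
  have hα := abs_neumannAlpha_le
  rcases eq_or_ne x 0 with rfl | hx
  · have h0 : ∀ n, besselJ (0 + 2 + 2 * n) 0 = 0 := fun n => by
      rw [show 0 + 2 + 2 * n = 2 * n + 1 + 1 by ring, besselJ_succ_zero]
    rw [tsum_mul_besselJ_eq_zero_add hα]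
    simp only [h0, besselJ_zero_zero, neumannAlpha_zero, mul_zero, tsum_zero, Real.sinc_zero]
    norm_num
  · have hs1 : Summable fun n => neumannAlpha (n + 1) * besselJ (0 + 2 + 2 * n) x := by
      have := (summable_nat_add_iff 1).2 (summable_mul_besselJ hα 0 x)
      refine this.congr fun n => ?_
      rw [show 0 + 2 * (n + 1) = 0 + 2 + 2 * n by ring]
    have hs2 : Summable fun n : ℕ => (-1 : ℝ) ^ (n + 1) / (2 * ((n + 1 : ℕ) : ℝ) + 1) *
        besselJ (0 + 2 + 2 * n) x := by
      have := (summable_nat_add_iff 1).2 (summable_mul_besselJ hc 0 x)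
      refine this.congr fun n => ?_
      rw [show 0 + 2 * (n + 1) = 0 + 2 + 2 * n by ring]
    have hA := tsum_mul_besselJ_eq_zero_add hα 0 x
    have hB := tsum_mul_besselJ_eq_zero_add hc 0 x
    have hsum := summable_mul_besselJ hα (0 + 2) x
    have hcsum := summable_mul_besselJ hc (0 + 2) x
    have hd : ∑' n, neumannAlpha (n + 1) * besselJ (0 + 2 + 2 * n) x -
        ∑' n, neumannAlpha n * besselJ (0 + 2 + 2 * n) x =
        ∑' n : ℕ, (-1 : ℝ) ^ (n + 1) / (2 * ((n + 1 : ℕ) : ℝ) + 1) * besselJ (0 + 2 + 2 * n) x +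
        ∑' n : ℕ, (-1 : ℝ) ^ n / (2 * n + 1) * besselJ (0 + 2 + 2 * n) x := by
      rw [← hs1.tsum_sub hsum, ← hs2.tsum_add hcsum]
      refine tsum_congr fun n => ?_
      rw [neumannAlpha_succ]
      push_cast
      ring
    have hJ : x * (∑' n : ℕ, (-1 : ℝ) ^ n / (2 * n + 1) * besselJ (0 + 2 * n) x +
        ∑' n : ℕ, (-1 : ℝ) ^ n / (2 * n + 1) * besselJ (0 + 2 + 2 * n) x) = Real.sin x := by
      rw [← sin_eq_tsum_besselJ, ← (summable_mul_besselJ hc 0 x).tsum_add hcsum, ← tsum_mul_left,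
        ← tsum_mul_left]
      refine tsum_congr fun n => ?_
      have := besselJ_rec (2 * n) x
      rw [show 0 + 2 * n = 2 * n by ring, show 0 + 2 + 2 * n = 2 * n + 2 by ring,
        show 1 + 2 * n = 2 * n + 1 by ring]
      push_cast at this
      have h1 : (2 : ℝ) * n + 1 ≠ 0 := by positivity
      field_simp
      linear_combination -this
    rw [Real.sinc_of_ne_zero hx, ← hJ, mul_div_cancel_left₀ _ hx, hA, hB, neumannAlpha_zero]
    simp only [pow_zero, Nat.cast_zero, mul_zero, zero_add, div_one] at hd ⊢
    linear_combination hd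

theorem tsum_neumannAlpha_mul_besselJ (x : ℝ) :
    ∑' n, neumannAlpha n * besselJ (0 + 1 + 2 * n) x = 1 / 2 * sinIntegral x := by
  have hD : ∀ y, HasDerivAt (fun y => ∑' n, neumannAlpha n * besselJ (0 + 1 + 2 * n) y -
      1 / 2 * ∫ t in (0 : ℝ)..y, Real.sinc t) 0 y := by
    intro y
    refine ((hasDerivAt_tsum_mul_besselJ abs_neumannAlpha_le 0 y).fun_sub
      ((intervalIntegral.integral_hasDerivAt_right
        (Real.continuous_sinc.intervalIntegrable _ _)
        Real.continuous_sinc.stronglyMeasurable.stronglyMeasurableAtFilter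
        Real.continuous_sinc.continuousAt).const_mul (1 / 2))).congr_deriv ?_
    rw [tsum_neumannAlpha_mul_besselJ_sub]
    ring
  have h := is_const_of_deriv_eq_zero (fun y => (hD y).differentiableAt)
    (fun y => (hD y).deriv) x 0
  simp only [show ∀ n, 0 + 1 + 2 * n = 2 * n + 1 by intro n; ring, besselJ_succ_zero,
    mul_zero, tsum_zero, intervalIntegral.integral_same, sub_zero] at h ⊢
  rw [sinIntegral_eq_integral_sinc]
  linarith

/-! ### Assembly of the statement. -/

theorem corollary1 :
    (∀ n : ℕ,
      MeasureTheory.IntegrableOn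
          (fun t : ℝ => sinIntegral t * besselJ (2 * n + 1) t / t) (Set.Ioi 0) ∧
      IntervalIntegrable
          (fun t : ℝ => Real.sin ((2 * (n : ℝ) + 1) * t) * Real.cot t)
          MeasureTheory.volume 0 (Real.pi / 2) ∧
      (∫ t in Set.Ioi (0 : ℝ), sinIntegral t * besselJ (2 * n + 1) t / t) =
          1 / (2 * (n : ℝ) + 1) *
            ∫ t in (0 : ℝ)..(Real.pi / 2), Real.sin ((2 * (n : ℝ) + 1) * t) * Real.cot t ∧
      (1 / (2 * (n : ℝ) + 1) *
          ∫ t in (0 : ℝ)..(Real.pi / 2), Real.sin ((2 * (n : ℝ) + 1) * t) * Real.cot t) =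
          neumannAlpha n / (2 * (n : ℝ) + 1) ∧
      neumannAlpha n / (2 * (n : ℝ) + 1) =
          ∑ k ∈ Finset.range (n + 1),
            ((n + k).factorial : ℝ) / ((n - k).factorial : ℝ) *
              (2 ^ (2 * k) * (-1 : ℝ) ^ k /
                ((2 * (k : ℝ) + 1) * ((2 * k + 1).factorial : ℝ)))) ∧
    (∀ x : ℝ, 0 ≤ x →
      HasSum (fun n : ℕ => neumannAlpha n * besselJ (2 * n + 1) x) (1 / 2 * sinIntegral x)) ∧
    (∀ n : ℕ,
      neumannAlpha n =
        2 * (2 * (n : ℝ) + 1) *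
          ∫ t in Set.Ioi (0 : ℝ), (1 / 2 * sinIntegral t) * besselJ (2 * n + 1) t / t) := by
  have hI : ∀ n : ℕ, (∫ t in Set.Ioi (0 : ℝ), sinIntegral t * besselJ (2 * n + 1) t / t) =
      1 / (2 * (n : ℝ) + 1) *
        ∫ t in (0 : ℝ)..(Real.pi / 2), Real.sin ((2 * (n : ℝ) + 1) * t) * Real.cot t := by
    intro n
    have := integral_sinIntegral_mul_besselJ_div (2 * n)
    push_cast at this
    exact this
  refine ⟨fun n => ⟨integrableOn_sinIntegral_mul_besselJ_div (2 * n),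
    intervalIntegrable_sin_odd_mul_mul_cot n, hI n, ?_, ?_⟩, fun x _ => ?_, fun n => ?_⟩
  · rw [integral_sin_odd_mul_mul_cot, one_div_mul_eq_div]
  · have hn : (2 : ℝ) * n + 1 ≠ 0 := by positivity
    rw [← integral_sin_odd_mul_mul_cot, integral_sin_odd_mul_mul_cot_eq_sum,
      mul_div_cancel_left₀ _ hn]
    refine Finset.sum_congr rfl fun k hk => ?_
    rw [centralProd_eq_factorial (Nat.lt_succ_iff.1 (Finset.mem_range.1 hk)),
      show (-4 : ℝ) = 2 ^ 2 * -1 by norm_num, mul_pow, ← pow_mul]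
    have hk1 : (2 : ℝ) * k + 1 ≠ 0 := by positivity
    field_simp
  -- Unconditional summability in `ℝ` is absolute convergence.
  · have h := (summable_mul_besselJ abs_neumannAlpha_le (0 + 1) x).hasSum
    rw [tsum_neumannAlpha_mul_besselJ] at h
    simpa only [show ∀ n, 0 + 1 + 2 * n = 2 * n + 1 by intro n; ring] using h
  · have hn : (2 : ℝ) * n + 1 ≠ 0 := by positivity
    have e : ∀ t : ℝ, 1 / 2 * sinIntegral t * besselJ (2 * n + 1) t / t =
        1 / 2 * (sinIntegral t * besselJ (2 * n + 1) t / t) := fun t => by ring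
    simp only [e, MeasureTheory.integral_const_mul]
    rw [hI, integral_sin_odd_mul_mul_cot]
    field_simp
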